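/- Let $0<c<1/2$. For real $M\ge 1$ and real $t$ put $D_M(t)=\sum_{n\le M} n^{-1/2-it}$, the sum running over the positive integers $n\le M$. There is a number $T_0$, depending only on $c$, such that for every real $T\ge T_0$ and every real $$M\ge \exp\left(e\sqrt{\tfrac12\,\log T\,\log\log T\,\log\log\log T}\right)$$ one has $$\max_{t\in[\sqrt T,\,T]}|D_M(t)|\ge \exp\left(c\,\sqrt{\frac{\log T\,\log\log\log T}{\log\log T}}\right).$$ -/

import Mathlib

/-- The Dirichlet polynomial `D_M(t) = ∑_{n ≤ M} n^{-1/2 - it}`, the sum running over the positive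
integers `n ≤ M`, where `M` is a real number. -/
noncomputable def dirichletPartialSum (M t : ℝ) : ℂ :=
  ∑ n ∈ Finset.Icc 1 ⌊M⌋₊, (n : ℂ) ^ (-(1 / 2 : ℂ) - Complex.I * (t : ℂ))

/-! The proof is by resonance. Weight $D_M(t)$ by $|R(t)|^2$ and a Gaussian of width $T/\log T$,
where $R$ is a Dirichlet polynomial imitating $\sum_{m\in S}F(m)m^{-it}$ with $F\ge 0$. The Gaussian
has a positive transform, so the weighted integral of $D_M$ is bounded below by its near-diagonal
terms. Hence $\sum_{n\le M} n^{-1/2}\sum_m F(m)F(mn)$ is at most $(C\max|D_M|+\text{error})\sum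
F^2$. This is `exists_resonance_inequality`; frequencies $\log m$ too close to be separated at this
resolution are first merged into cells of length $\delta=\log T/T$.

Write $l=\log T$, $x=\log l$, $z=\log x$, $y=lx$ and $u_p=\log(p/y)$. Take $F(m)=\prod_{p\mid
m}f(p)$ with $f(p)=\lambda/(u_p\sqrt p)$, on squarefree $m$ composed of primes slightly beyond $y$.
Without truncation the quotient is about $\exp(\sum f(p)/\sqrt p)$, and $\lambda=s\sqrt{lx/z}$ makes
this $\exp(s\sqrt{lz/x})$. The set $S$ keeps those $m$ with $\sum_{p\mid m}g(p)\le A$, where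
$g(p)\approx u_p$ up to a constant. Rankin's trick gives both $|S|\le T^{s^2+o(1)}$ and the
negligibility of the discarded terms; it also handles the restriction $n\le M$, which is where the
lower bound on $M$ enters (`exists_resonator_of_bounds`). The prime sums needed come from Mertens'
theorem (`eventually_exists_primes`).

The constant $1/2$ comes from balancing two ranges of $M$. If $M\ge T^{3/2+\varepsilon}$, the main
term $M^{1/2-it}/(1/2-it)$ already makes $|D_M(\sqrt T)|$ a power of $T$
(`exp_sqrt_log_le_norm_of_large`). If $M<T^{3/2+\varepsilon}$, the times outside $[\sqrt T,T]$
contribute about $|S|\,T^{-1}\sqrt M$, which is harmless for $|S|\le T^{(1/2-\varepsilon)^2}$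
(`resonance_error_le_one`). So $s$ may approach $1/2$. -/

open Filter Topology MeasureTheory

/-! ### Mertens' first theorem from the factorization of $n!$. -/

/-- Legendre's formula bounds: `n / p - 1 ≤ v_p(n!)`. -/
lemma div_sub_one_le_factorization_factorial (n p : ℕ) (hp : p.Prime) :
    (n : ℝ) / p - 1 ≤ (n.factorial.factorization p : ℝ) := by
  have := Fact.mk hp
  have h1 : n / p ≤ n.factorial.factorization p := by
    have hd : p ^ (n / p) ∣ n.factorial := by
      have : (p * (n / p)).factorial ∣ n.factorial :=
        Nat.factorial_dvd_factorial (Nat.mul_div_le n p)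
      refine dvd_trans ?_ this
      exact (padicValNat_dvd_iff_le (Nat.factorial_ne_zero _)).2 (by
        rw [padicValNat_factorial_mul]; omega)
    exact (hp.pow_dvd_iff_le_factorization (Nat.factorial_ne_zero _)).1 hd
  have h2 : (n : ℝ) / p - 1 ≤ ((n / p : ℕ) : ℝ) := by
    have := Nat.lt_floor_add_one ((n : ℝ) / p)
    rw [Nat.floor_div_eq_div] at this
    linarith
  exact h2.trans (by exact_mod_cast h1)

lemma factorization_factorial_le (n p : ℕ) (hp : p.Prime) :
    (n.factorial.factorization p : ℝ) ≤ n / ((p : ℝ) - 1) := by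
  have := Fact.mk hp
  have h := sub_one_mul_padicValNat_factorial (p := p) n
  have hp1 : (1 : ℝ) < p := by exact_mod_cast hp.one_lt
  rw [le_div_iff₀ (by linarith), Nat.factorization_def _ hp]
  have h' : (p - 1) * padicValNat p n.factorial ≤ n := by rw [h]; omega
  have h'' : (((p - 1) * padicValNat p n.factorial : ℕ) : ℝ) ≤ n := by exact_mod_cast h'
  rw [Nat.cast_mul, Nat.cast_sub hp.one_lt.le] at h''
  push_cast at h''
  linarith

lemma log_factorial_eq_sum_primes (n : ℕ) :
    Real.log n.factorial =
      ∑ p ∈ Nat.primesLE n, (n.factorial.factorization p : ℝ) * Real.log p := by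
  conv_lhs => rw [← Nat.prod_factorization_pow_eq_self (Nat.factorial_ne_zero n)]
  rw [Finsupp.prod, Nat.cast_prod, Real.log_prod]
  · rw [Nat.support_factorization]
    have : n.factorial.primeFactors ⊆ Nat.primesLE n := by
      intro p hp
      have hpp := Nat.prime_of_mem_primeFactors hp
      rw [Nat.mem_primesLE]
      exact ⟨(hpp.dvd_factorial).1 (Nat.dvd_of_mem_primeFactors hp), hpp⟩
    rw [← Finset.sum_subset this]
    · refine Finset.sum_congr rfl fun p _ => ?_
      push_cast
      rw [Real.log_pow]
    · intro p _ hp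
      have : n.factorial.factorization p = 0 := by
        rw [← Finsupp.notMem_support_iff, Nat.support_factorization]; exact hp
      simp [this]
  · intro p hp
    have := Nat.pos_of_mem_primeFactors (Nat.support_factorization _ ▸ hp)
    positivity

/-- The left side is the excess of $\log p/(p-1)$ over $\log p/p$, the price of higher prime powers
in $n!$; the majorant is summable. -/
lemma log_div_mul_sub_one_le (p : ℕ) (hp : 2 ≤ p) :
    Real.log p / (p * ((p : ℝ) - 1)) ≤ 4 * (1 / (p : ℝ) ^ (3 / 2 : ℝ)) := by
  have hp2 : (2 : ℝ) ≤ p := by exact_mod_cast hp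
  have hlog : Real.log p ≤ 2 * (p : ℝ) ^ (1 / 2 : ℝ) := by
    have := Real.log_le_rpow_div (x := (p : ℝ)) (by linarith) (ε := 1 / 2) (by norm_num)
    linarith
  have h2 : (p : ℝ) ^ (3 / 2 : ℝ) * (p : ℝ) ^ (1 / 2 : ℝ) = p * p := by
    rw [← Real.rpow_add (by linarith)]; norm_num; ring
  have hpos : (0 : ℝ) < (p : ℝ) ^ (3 / 2 : ℝ) := by positivity
  rw [mul_one_div, div_le_div_iff₀ (by nlinarith) hpos]
  calc Real.log p * (p : ℝ) ^ (3 / 2 : ℝ)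
      ≤ 2 * (p : ℝ) ^ (1 / 2 : ℝ) * (p : ℝ) ^ (3 / 2 : ℝ) := by gcongr
    _ = 2 * (p * p) := by rw [← h2]; ring
    _ ≤ 4 * (p * ((p : ℝ) - 1)) := by nlinarith

/-- Mertens' first theorem at natural numbers. -/
lemma exists_abs_sum_log_div_sub_log_le_nat :
    ∃ C : ℝ, ∀ n : ℕ, 1 ≤ n →
      |∑ p ∈ Nat.primesLE n, Real.log p / p - Real.log n| ≤ C := by
  have hs : Summable fun p : ℕ => 1 / (p : ℝ) ^ (3 / 2 : ℝ) :=
    Real.summable_one_div_nat_rpow.2 (by norm_num)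
  set Z := ∑' p : ℕ, 1 / (p : ℝ) ^ (3 / 2 : ℝ)
  have hZ : 0 ≤ Z := tsum_nonneg fun p => by positivity
  refine ⟨Real.log 4 + 1 + 4 * Z, fun n hn => ?_⟩
  have hn0 : (0 : ℝ) < n := by exact_mod_cast hn
  have hl4 : 0 < Real.log 4 := Real.log_pos (by norm_num)
  have hfac := log_factorial_eq_sum_primes n
  have htheta : ∑ p ∈ Nat.primesLE n, Real.log p ≤ Real.log 4 * n := by
    rw [← Chebyshev.theta_eq_sum_primesLE_log]
    exact Chebyshev.theta_le_log4_mul_x hn0.le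
  have hup : Real.log n.factorial ≤ n * Real.log n := by
    rw [← Real.log_pow]
    refine Real.log_le_log (by positivity) ?_
    exact_mod_cast Nat.factorial_le_pow n
  have hlow : n * Real.log n - n ≤ Real.log n.factorial := by
    have := Stirling.le_log_factorial_stirling (n := n) (by omega)
    have h1 : 0 ≤ Real.log n := Real.log_natCast_nonneg n
    have h2 : 0 ≤ Real.log (2 * Real.pi) := Real.log_nonneg (by linarith [Real.pi_gt_three])
    linarith
  have hpr : ∀ p ∈ Nat.primesLE n, p.Prime := fun p hp => (Nat.mem_primesLE.1 hp).2
  rw [abs_le]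
  constructor
  · have h1 : Real.log n.factorial ≤
        n * ∑ p ∈ Nat.primesLE n, (Real.log p / p + Real.log p / (p * ((p : ℝ) - 1))) := by
      rw [hfac, Finset.mul_sum]
      refine Finset.sum_le_sum fun p hp => ?_
      have hp' := hpr p hp
      have hp1 : (1 : ℝ) < p := by exact_mod_cast hp'.one_lt
      calc (n.factorial.factorization p : ℝ) * Real.log p
          ≤ n / ((p : ℝ) - 1) * Real.log p := by
            gcongr
            exact factorization_factorial_le n p hp'
        _ = _ := by
            have : (p : ℝ) - 1 ≠ 0 := by linarith
            field_simp
            ring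
    have h2 : ∑ p ∈ Nat.primesLE n, Real.log p / (p * ((p : ℝ) - 1)) ≤ 4 * Z := by
      calc _ ≤ ∑ p ∈ Nat.primesLE n, 4 * (1 / (p : ℝ) ^ (3 / 2 : ℝ)) :=
            Finset.sum_le_sum fun p hp => log_div_mul_sub_one_le p (hpr p hp).two_le
        _ = 4 * ∑ p ∈ Nat.primesLE n, (1 / (p : ℝ) ^ (3 / 2 : ℝ)) := by rw [Finset.mul_sum]
        _ ≤ 4 * Z := by
            gcongr
            exact hs.sum_le_tsum _ fun p _ => by positivity
    rw [Finset.sum_add_distrib] at h1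
    have h3 : n * (Real.log n - 1) ≤
        n * (∑ p ∈ Nat.primesLE n, Real.log p / p + 4 * Z) :=
      calc _ ≤ Real.log n.factorial := by linarith
        _ ≤ _ := h1
        _ ≤ _ := by gcongr
    have h4 := le_of_mul_le_mul_left h3 hn0
    linarith
  · have h1 : n * ∑ p ∈ Nat.primesLE n, Real.log p / p - ∑ p ∈ Nat.primesLE n, Real.log p ≤
        Real.log n.factorial := by
      rw [hfac, Finset.mul_sum, ← Finset.sum_sub_distrib]
      refine Finset.sum_le_sum fun p hp => ?_
      have := div_sub_one_le_factorization_factorial n p (hpr p hp)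
      calc n * (Real.log p / p) - Real.log p = ((n : ℝ) / p - 1) * Real.log p := by ring
        _ ≤ _ := by
          gcongr
    have h3 : n * (∑ p ∈ Nat.primesLE n, Real.log p / p) ≤ n * (Real.log n + Real.log 4) := by
      linarith
    have h4 := le_of_mul_le_mul_left h3 hn0
    linarith

/-- Mertens' first theorem on intervals. -/
lemma exists_abs_sum_log_div_Ioc_le :
    ∃ C : ℝ, 0 ≤ C ∧ ∀ x z : ℝ, 1 ≤ x → x ≤ z →
      |∑ p ∈ (Nat.primesLE ⌊z⌋₊ \ Nat.primesLE ⌊x⌋₊), Real.log p / p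
        - (Real.log z - Real.log x)| ≤ C := by
  obtain ⟨C, hC⟩ := exists_abs_sum_log_div_sub_log_le_nat
  have hfl : ∀ x : ℝ, 1 ≤ x → |Real.log ⌊x⌋₊ - Real.log x| ≤ Real.log 2 := by
    intro x hx
    have h1 : (1 : ℝ) ≤ ⌊x⌋₊ := by exact_mod_cast (Nat.one_le_floor_iff x).2 hx
    have h2 : (⌊x⌋₊ : ℝ) ≤ x := Nat.floor_le (by linarith)
    have h3 : x < ⌊x⌋₊ + 1 := Nat.lt_floor_add_one x
    have h4 : Real.log ⌊x⌋₊ ≤ Real.log x := Real.log_le_log (by linarith) h2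
    have h5 : Real.log x ≤ Real.log (2 * ⌊x⌋₊) := Real.log_le_log (by linarith) (by linarith)
    rw [Real.log_mul (by norm_num) (by linarith)] at h5
    rw [abs_le]
    constructor <;> linarith [Real.log_pos (show (1 : ℝ) < 2 by norm_num)]
  have hC0 : 0 ≤ C := (abs_nonneg _).trans (hC 1 le_rfl)
  have hl2 := Real.log_pos (show (1 : ℝ) < 2 by norm_num)
  refine ⟨2 * C + 2 * Real.log 2, by positivity, fun x z hx hxz => ?_⟩
  have hsub : Nat.primesLE ⌊x⌋₊ ⊆ Nat.primesLE ⌊z⌋₊ := by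
    intro p hp
    rw [Nat.mem_primesLE] at hp ⊢
    exact ⟨hp.1.trans (Nat.floor_mono hxz), hp.2⟩
  rw [Finset.sum_sdiff_eq_sub hsub]
  have h1 := abs_le.1 (hC ⌊x⌋₊ ((Nat.one_le_floor_iff x).2 hx))
  have h2 := abs_le.1 (hC ⌊z⌋₊ ((Nat.one_le_floor_iff z).2 (hx.trans hxz)))
  have h3 := abs_le.1 (hfl x hx)
  have h4 := abs_le.1 (hfl z (hx.trans hxz))
  rw [abs_le]
  constructor <;> linarith [h1.1, h1.2, h2.1, h2.2, h3.1, h3.2, h4.1, h4.2]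

/-! ### Weighted reciprocal sums over primes slightly beyond $\ell\log\ell$. -/

/-- The primes in the interval `(y e^{B(k+1)}, y e^{B(k+2)}]`. -/
noncomputable def primeBlock (y B : ℝ) (k : ℕ) : Finset ℕ :=
  Nat.primesLE ⌊y * Real.exp (B * (k + 2))⌋₊ \ Nat.primesLE ⌊y * Real.exp (B * (k + 1))⌋₊

lemma mem_primeBlock {y B : ℝ} (hy : 1 ≤ y) {k p : ℕ} (hp : p ∈ primeBlock y B k) :
    p.Prime ∧ B * (k + 1) < Real.log p - Real.log y ∧ Real.log p - Real.log y ≤ B * (k + 2) := by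
  rw [primeBlock, Finset.mem_sdiff, Nat.mem_primesLE, Nat.mem_primesLE] at hp
  obtain ⟨⟨h1, hpp⟩, h2⟩ := hp
  have h3 : ⌊y * Real.exp (B * (k + 1))⌋₊ < p := by
    by_contra h; exact h2 ⟨not_lt.1 h, hpp⟩
  have hy0 : 0 < y := by linarith
  have hp0 : (0 : ℝ) < p := by exact_mod_cast hpp.pos
  rw [Nat.le_floor_iff (by positivity)] at h1
  rw [Nat.floor_lt (by positivity)] at h3
  refine ⟨hpp, ?_, ?_⟩
  · have := Real.log_lt_log (by positivity) h3
    rw [Real.log_mul hy0.ne' (Real.exp_pos _).ne', Real.log_exp] at this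
    linarith
  · have := Real.log_le_log hp0 h1
    rw [Real.log_mul hy0.ne' (Real.exp_pos _).ne', Real.log_exp] at this
    linarith

/-- Every block has logarithmic length $B$, while the Mertens error $C$ does not depend on its
position. A large $B$ therefore makes the relative error small on all blocks at once. -/
lemma sum_log_div_primeBlock {C : ℝ}
    (hC : ∀ x z : ℝ, 1 ≤ x → x ≤ z →
      |∑ p ∈ (Nat.primesLE ⌊z⌋₊ \ Nat.primesLE ⌊x⌋₊), Real.log p / p
        - (Real.log z - Real.log x)| ≤ C) {y B : ℝ} (hy : 1 ≤ y) (hB : 0 ≤ B) (k : ℕ) :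
    B - C ≤ ∑ p ∈ primeBlock y B k, Real.log p / p ∧
      ∑ p ∈ primeBlock y B k, Real.log p / p ≤ B + C := by
  have hy0 : 0 < y := by linarith
  have h1 : 1 ≤ y * Real.exp (B * (k + 1)) := by
    have : 1 ≤ Real.exp (B * (k + 1)) := Real.one_le_exp (by positivity)
    nlinarith
  have h2 : y * Real.exp (B * (k + 1)) ≤ y * Real.exp (B * (k + 2)) := by gcongr; norm_num
  have h := abs_le.1 (hC _ _ h1 h2)
  rw [Real.log_mul hy0.ne' (Real.exp_pos _).ne', Real.log_exp,
    Real.log_mul hy0.ne' (Real.exp_pos _).ne', Real.log_exp] at h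
  rw [primeBlock]
  constructor <;> linarith [h.1, h.2]

lemma pairwiseDisjoint_primeBlock {y B : ℝ} (hy : 1 ≤ y) (hB : 0 < B) (s : Set ℕ) :
    s.PairwiseDisjoint (primeBlock y B) := by
  have key : ∀ i j : ℕ, i < j → Disjoint (primeBlock y B i) (primeBlock y B j) := by
    intro i j hij
    rw [Finset.disjoint_left]
    intro p hp hp'
    have h1 := (mem_primeBlock hy hp).2.2
    have h2 := (mem_primeBlock hy hp').2.1
    have h3 : (i : ℝ) + 1 ≤ j := by exact_mod_cast hij
    nlinarith
  intro i _ j _ hij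
  rcases lt_or_gt_of_ne hij with h | h
  · exact key i j h
  · exact (key j i h).symm

lemma sum_range_inv_sq_le (K : ℕ) : ∑ k ∈ Finset.range K, 1 / ((k : ℝ) + 1) ^ 2 ≤ 2 := by
  have : ∀ K : ℕ, ∑ k ∈ Finset.range (K + 1), 1 / ((k : ℝ) + 1) ^ 2 ≤ 2 - 1 / ((K : ℝ) + 1) := by
    intro K
    induction K with
    | zero => norm_num
    | succ n ih =>
      rw [Finset.sum_range_succ]
      have hle : 1 / (((n + 1 : ℕ) : ℝ) + 1) ^ 2 ≤ 1 / ((n : ℝ) + 1) - 1 / ((n : ℝ) + 2) := by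
        rw [div_sub_div _ _ (by positivity) (by positivity), div_le_div_iff₀ (by positivity)
          (by positivity)]
        push_cast
        nlinarith [(Nat.cast_nonneg n : (0 : ℝ) ≤ n)]
      have h2 : 1 / (((n + 1 : ℕ) : ℝ) + 1) = 1 / ((n : ℝ) + 2) := by push_cast; ring
      rw [h2]
      linarith
  rcases K with _ | K
  · norm_num
  · have := this K
    have h : 0 < 1 / ((K : ℝ) + 1) := by positivity
    linarith

lemma sum_range_inv_le (K : ℕ) : ∑ k ∈ Finset.range K, 1 / ((k : ℝ) + 1) ≤ 1 + Real.log K := by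
  have := harmonic_le_one_add_log K
  rw [harmonic] at this
  push_cast at this
  simpa using this

lemma log_sub_one_le_sum_range_inv (K : ℕ) (hK : 1 ≤ K) :
    Real.log K - 1 ≤ ∑ k ∈ Finset.range K, 1 / ((k : ℝ) + 2) := by
  have := log_add_one_le_harmonic (K + 1)
  rw [harmonic, Finset.sum_range_succ'] at this
  push_cast at this
  have h2 : Real.log K ≤ Real.log ((K : ℝ) + 1 + 1) :=
    Real.log_le_log (by exact_mod_cast hK) (by linarith)
  have h3 : ∑ k ∈ Finset.range K, 1 / ((k : ℝ) + 2)
      = ∑ k ∈ Finset.range K, ((k : ℝ) + 1 + 1)⁻¹ := by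
    refine Finset.sum_congr rfl fun k _ => ?_
    rw [one_div]; ring_nf
  rw [h3]
  norm_num at this
  linarith

/-- Weighted sums over the primes in `(y e^B, y e^{B(K+1)}]`. -/
lemma exists_prime_set_sum_bounds {C : ℝ} (hC0 : 0 ≤ C)
    (hC : ∀ x z : ℝ, 1 ≤ x → x ≤ z →
      |∑ p ∈ (Nat.primesLE ⌊z⌋₊ \ Nat.primesLE ⌊x⌋₊), Real.log p / p
        - (Real.log z - Real.log x)| ≤ C) {y B : ℝ} (hy : 1 < y) (hB : 1 ≤ B) (hCB : C ≤ B)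
    (K : ℕ) (hK : 1 ≤ K) :
    ∃ P : Finset ℕ, (∀ p ∈ P, p.Prime ∧ B < Real.log p - Real.log y ∧
        Real.log p - Real.log y ≤ B * (K + 1)) ∧
      (1 - C / B) * (Real.log K - 1) / (Real.log y + B * (K + 1)) ≤
        ∑ p ∈ P, 1 / (p * (Real.log p - Real.log y)) ∧
      ∑ p ∈ P, 1 / (p * (Real.log p - Real.log y)) ≤ (1 + C / B) * (1 + Real.log K) / Real.log y ∧
      ∑ p ∈ P, 1 / (p * (Real.log p - Real.log y) ^ 2) ≤ 4 / B / Real.log y := by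
  have hB0 : 0 < B := by linarith
  have hly : 0 < Real.log y := Real.log_pos hy
  have hdisj := pairwiseDisjoint_primeBlock hy.le hB0 (↑(Finset.range K) : Set ℕ)
  have hblock : ∀ k ∈ Finset.range K, ∀ p ∈ primeBlock y B k, p.Prime ∧ (0 : ℝ) < p ∧
      B * (k + 1) < Real.log p - Real.log y ∧ Real.log p - Real.log y ≤ B * (k + 2) ∧
      0 < B * (k + 1) ∧ Real.log p ≤ Real.log y + B * (K + 1) ∧ Real.log y < Real.log p := by
    intro k hk p hp
    obtain ⟨h1, h2, h3⟩ := mem_primeBlock hy.le hp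
    have hk' : (k : ℝ) + 1 ≤ K := by exact_mod_cast Finset.mem_range.1 hk
    have h4 : 0 < B * ((k : ℝ) + 1) := by positivity
    refine ⟨h1, by exact_mod_cast h1.pos, h2, h3, h4, ?_, by linarith⟩
    nlinarith
  refine ⟨(Finset.range K).biUnion (primeBlock y B), ?_, ?_, ?_, ?_⟩
  · intro p hp
    obtain ⟨k, hk, hp⟩ := Finset.mem_biUnion.1 hp
    obtain ⟨h1, -, h2, h3, -, h4, -⟩ := hblock k hk p hp
    refine ⟨h1, ?_, by linarith⟩
    have : (0 : ℝ) ≤ k := Nat.cast_nonneg k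
    nlinarith
  · rw [Finset.sum_biUnion hdisj]
    -- On block $k$, $1/(pu)=(\log p/p)\cdot 1/(u\log p)$ with $u\le B(k+2)$ and $\log p\le\log
    -- y+B(K+1)$, so Mertens on the block gives a term of a harmonic sum.
    have hb : ∀ k ∈ Finset.range K,
        (1 - C / B) / (Real.log y + B * (K + 1)) * (1 / ((k : ℝ) + 2)) ≤
          ∑ p ∈ primeBlock y B k, 1 / (p * (Real.log p - Real.log y)) := by
      intro k hk
      have hE := (sum_log_div_primeBlock hC hy.le hB0.le k).1
      have hD : 0 < (Real.log y + B * (K + 1)) := by positivity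
      calc (1 - C / B) / (Real.log y + B * (K + 1)) * (1 / ((k : ℝ) + 2))
          = (B - C) * (1 / ((B * (k + 2)) * (Real.log y + B * (K + 1)))) := by field_simp
        _ ≤ (∑ p ∈ primeBlock y B k, Real.log p / p) *
            (1 / ((B * (k + 2)) * (Real.log y + B * (K + 1)))) := by gcongr
        _ ≤ _ := by
          rw [Finset.sum_mul]
          refine Finset.sum_le_sum fun p hp => ?_
          obtain ⟨-, hp0, h2, h3, h4, h5, h6⟩ := hblock k hk p hp
          have hl : 0 < Real.log p := by linarith
          have hu : 0 < Real.log p - Real.log y := by linarith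
          calc Real.log p / p * (1 / ((B * (k + 2)) * (Real.log y + B * (K + 1))))
              ≤ Real.log p / p * (1 / ((Real.log p - Real.log y) * Real.log p)) := by gcongr
            _ = _ := by field_simp
    refine le_trans ?_ (Finset.sum_le_sum hb)
    rw [← Finset.mul_sum, div_mul_eq_mul_div]
    have h1 : C / B ≤ 1 := (div_le_one hB0).2 hCB
    gcongr
    exact log_sub_one_le_sum_range_inv K hK
  · rw [Finset.sum_biUnion hdisj]
    have hb : ∀ k ∈ Finset.range K,
        ∑ p ∈ primeBlock y B k, 1 / (p * (Real.log p - Real.log y)) ≤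
        (1 + C / B) / Real.log y * (1 / ((k : ℝ) + 1)) := by
      intro k hk
      have hE := (sum_log_div_primeBlock hC hy.le hB0.le k).2
      calc ∑ p ∈ primeBlock y B k, 1 / (p * (Real.log p - Real.log y))
          ≤ (∑ p ∈ primeBlock y B k, Real.log p / p) * (1 / ((B * (k + 1)) * Real.log y)) := by
              rw [Finset.sum_mul]
              refine Finset.sum_le_sum fun p hp => ?_
              obtain ⟨-, hp0, h2, h3, h4, h5, h6⟩ := hblock k hk p hp
              have hl : 0 < Real.log p := by linarith
              have hu : 0 < Real.log p - Real.log y := by linarith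
              calc 1 / (p * (Real.log p - Real.log y))
                  = Real.log p / p * (1 / ((Real.log p - Real.log y) * Real.log p)) := by field_simp
                _ ≤ _ := by gcongr
        _ ≤ (B + C) * (1 / ((B * (k + 1)) * Real.log y)) := by gcongr
        _ = _ := by field_simp
    refine (Finset.sum_le_sum hb).trans ?_
    rw [← Finset.mul_sum, div_mul_eq_mul_div]
    gcongr
    exact sum_range_inv_le K
  · rw [Finset.sum_biUnion hdisj]
    have hb : ∀ k ∈ Finset.range K,
        ∑ p ∈ primeBlock y B k, 1 / (p * (Real.log p - Real.log y) ^ 2) ≤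
        2 / B / Real.log y * (1 / ((k : ℝ) + 1) ^ 2) := by
      intro k hk
      have hE := (sum_log_div_primeBlock hC hy.le hB0.le k).2
      calc ∑ p ∈ primeBlock y B k, 1 / (p * (Real.log p - Real.log y) ^ 2)
          ≤ (∑ p ∈ primeBlock y B k, Real.log p / p) * (1 / ((B * (k + 1)) ^ 2 * Real.log y)) := by
              rw [Finset.sum_mul]
              refine Finset.sum_le_sum fun p hp => ?_
              obtain ⟨-, hp0, h2, h3, h4, h5, h6⟩ := hblock k hk p hp
              have hl : 0 < Real.log p := by linarith
              have hu : 0 < Real.log p - Real.log y := by linarith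
              calc 1 / (p * (Real.log p - Real.log y) ^ 2)
                  = Real.log p / p * (1 / ((Real.log p - Real.log y) ^ 2 * Real.log p)) := by
                    field_simp
                _ ≤ _ := by gcongr
        _ ≤ (B + B) * (1 / ((B * (k + 1)) ^ 2 * Real.log y)) := by
            gcongr
            linarith
        _ = _ := by field_simp; ring
    refine (Finset.sum_le_sum hb).trans ?_
    rw [← Finset.mul_sum]
    calc 2 / B / Real.log y * ∑ k ∈ Finset.range K, 1 / ((k : ℝ) + 1) ^ 2
        ≤ 2 / B / Real.log y * 2 := by gcongr; exact sum_range_inv_sq_le K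
      _ = _ := by ring

/-- For large `ℓ` there is a set of primes slightly larger than `y = ℓ log ℓ` with
prescribed weighted reciprocal sums. -/
lemma eventually_exists_primes (ε : ℝ) (hε0 : 0 < ε) (hε1 : ε ≤ 1) :
    ∀ᶠ l : ℝ in atTop, ∃ P : Finset ℕ,
      (∀ p ∈ P, p.Prime ∧ 1 ≤ Real.log p - Real.log (l * Real.log l) ∧
        Real.log p - Real.log (l * Real.log l) ≤ ε * Real.log l) ∧
      (1 - ε) * (Real.log (Real.log l) / Real.log l) ≤
        ∑ p ∈ P, 1 / (p * (Real.log p - Real.log (l * Real.log l))) ∧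
      ∑ p ∈ P, 1 / (p * (Real.log p - Real.log (l * Real.log l))) ≤
        (1 + ε) * (Real.log (Real.log l) / Real.log l) ∧
      ∑ p ∈ P, 1 / (p * (Real.log p - Real.log (l * Real.log l)) ^ 2) ≤ 1 / Real.log l := by
  obtain ⟨C, hC0, hC⟩ := exists_abs_sum_log_div_Ioc_le
  -- The second entry makes the relative Mertens error $C/B$ at most $\varepsilon/4$; the first
  -- turns the bound $4/(B\log y)$ into $1/\log\ell$.
  set B : ℝ := max 4 (4 * C / ε) with hBdef
  have hB4 : 4 ≤ B := le_max_left _ _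
  have hB0 : 0 < B := by linarith
  have hCB' : 4 * C / ε ≤ B := le_max_right _ _
  have hCBε : C / B ≤ ε / 4 := by
    rw [div_le_iff₀ hε0] at hCB'
    rw [div_le_iff₀ hB0]
    linarith
  have hCB : C ≤ B := by
    rw [div_le_iff₀ hB0] at hCBε
    nlinarith
  have hpow : Tendsto (fun x : ℝ => x ^ (1 - ε / 4)) atTop atTop :=
    tendsto_rpow_atTop (by linarith)
  have hlog := Real.tendsto_log_atTop
  have e1 : ∀ᶠ x : ℝ in atTop, B * (x ^ (1 - ε / 4) + 1) ≤ ε / 8 * x := by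
    have h2 := (tendsto_rpow_neg_atTop (show 0 < ε / 4 by positivity)).eventually_le_const
      (show 0 < ε / (16 * B) by positivity)
    filter_upwards [h2, eventually_ge_atTop (16 * B / ε), eventually_gt_atTop 0] with x hx hx2 hx0
    rw [div_le_iff₀ hε0] at hx2
    have h3 : x ^ (1 - ε / 4) = x ^ (-(ε / 4)) * x := by
      rw [← Real.rpow_add_one hx0.ne']; ring_nf
    have h4 : B * x ^ (1 - ε / 4) ≤ B * (ε / (16 * B) * x) := by rw [h3]; gcongr
    have h5 : B * (ε / (16 * B) * x) = ε / 16 * x := by field_simp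
    linarith
  have e2 : ∀ᶠ x : ℝ in atTop, Real.log x ≤ ε / 8 * x := by
    have h2 := Real.isLittleO_log_id_atTop.bound (show 0 < ε / 8 by positivity)
    filter_upwards [h2, eventually_gt_atTop 1] with x hx hx0
    rw [id, Real.norm_of_nonneg (Real.log_nonneg hx0.le), Real.norm_of_nonneg (by linarith)] at hx
    exact hx
  have e3 : ∀ᶠ x : ℝ in atTop, 8 / ε ≤ Real.log x := hlog.eventually_ge_atTop _
  have e4 : ∀ᶠ x : ℝ in atTop, 1 ≤ x ^ (1 - ε / 4) := hpow.eventually_ge_atTop _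
  have ex := hlog.eventually (e1.and (e2.and (e3.and (e4.and (eventually_ge_atTop (2 : ℝ))))))
  filter_upwards [ex, eventually_ge_atTop (2 : ℝ)] with l hl hl2
  obtain ⟨h1, h2, h3, h4, h5⟩ := hl
  set x := Real.log l with hx
  have hx0 : 0 < x := by linarith
  set z := Real.log x with hz
  have hly : Real.log (l * x) = x + z := by rw [Real.log_mul (by linarith) (by linarith)]
  have hz0 : 0 < z := lt_of_lt_of_le (by positivity) h3
  -- This $K$ is large enough that $\log K$ is nearly $\log x$, yet $BK=o(x)$, so that $\log p\sim
  -- x$ on the whole range.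
  set K := ⌊x ^ (1 - ε / 4)⌋₊ with hKdef
  have hK1 : 1 ≤ K := (Nat.one_le_floor_iff _).2 h4
  have hK1' : (1 : ℝ) ≤ K := by exact_mod_cast hK1
  have hKle : (K : ℝ) ≤ x ^ (1 - ε / 4) := Nat.floor_le (by positivity)
  have hKlt : x ^ (1 - ε / 4) < K + 1 := Nat.lt_floor_add_one _
  have hlogKup : Real.log K ≤ (1 - ε / 4) * z := by
    have := Real.log_le_log (by linarith) hKle
    rwa [Real.log_rpow hx0] at this
  have hlogKlow : (1 - ε / 4) * z - 1 ≤ Real.log K := by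
    have h6 : Real.log (x ^ (1 - ε / 4)) ≤ Real.log (2 * K) :=
      Real.log_le_log (by linarith) (by linarith)
    rw [Real.log_rpow hx0, Real.log_mul (by norm_num) (by linarith)] at h6
    have : Real.log 2 ≤ 1 := by linarith [Real.log_two_lt_d9]
    linarith
  have hBK : B * ((K : ℝ) + 1) ≤ ε / 8 * x := le_trans (by gcongr) h1
  rw [div_le_iff₀ hε0] at h3
  obtain ⟨P, hP1, hP2, hP3, hP4⟩ := exists_prime_set_sum_bounds hC0 hC (y := l * x) (B := B)
    (by nlinarith) (by linarith) hCB K hK1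
  rw [hly] at hP1 hP2 hP3 hP4 ⊢
  refine ⟨P, fun p hp => ⟨(hP1 p hp).1, by linarith [(hP1 p hp).2.1], ?_⟩, ?_, ?_, ?_⟩
  · have := (hP1 p hp).2.2
    nlinarith
  · refine le_trans ?_ hP2
    rw [← mul_div_assoc, div_le_div_iff₀ hx0 (by positivity)]
    have a1 : x + z + B * (K + 1) ≤ (1 + ε / 4) * x := by linarith
    have a2 : (1 - ε / 2) * z ≤ Real.log K - 1 := by nlinarith
    have a3 : 1 - ε / 4 ≤ 1 - C / B := by linarith
    calc (1 - ε) * z * (x + z + B * (K + 1)) ≤ (1 - ε) * z * ((1 + ε / 4) * x) := by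
          gcongr
      _ = ((1 - ε) * (1 + ε / 4)) * (z * x) := by ring
      _ ≤ ((1 - ε / 4) * (1 - ε / 2)) * (z * x) := by
          gcongr ?_ * _
          nlinarith
      _ = (1 - ε / 4) * ((1 - ε / 2) * z) * x := by ring
      _ ≤ (1 - C / B) * (Real.log K - 1) * x := by
          have a4 : 0 ≤ (1 - ε / 2) * z := mul_nonneg (by linarith) hz0.le
          have a5 : 0 ≤ 1 - C / B := by linarith
          gcongr
  · refine hP3.trans ?_
    rw [← mul_div_assoc, div_le_div_iff₀ (by positivity) hx0]
    have b1 : 1 + Real.log K ≤ (1 + ε / 4) * z := by nlinarith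
    have b2 : 0 ≤ Real.log K := Real.log_nonneg hK1'
    calc (1 + C / B) * (1 + Real.log K) * x ≤ (1 + ε / 4) * ((1 + ε / 4) * z) * x := by gcongr
      _ = ((1 + ε / 4) * (1 + ε / 4)) * (z * x) := by ring
      _ ≤ (1 + ε) * (z * x) := by
          gcongr
          nlinarith
      _ = (1 + ε) * z * x := by ring
      _ ≤ (1 + ε) * z * (x + z) := by gcongr; linarith
  · refine hP4.trans ?_
    rw [div_div, div_le_div_iff₀ (by positivity) hx0]
    have : x * 4 ≤ x * B := by gcongr
    have : 0 < B * z := by positivity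
    linarith

/-! ### The truncated resonator set and Rankin's trick. -/

/-- For a pair $U\subseteq S\subseteq P$ each prime has three states: outside $S$, in $U$, or in
$S\setminus U$. These give the summands $1$, $b$ and $a$ of its Euler factor. -/
lemma sum_sigma_powerset_prod_mul_prod (P : Finset ℕ) (a b : ℕ → ℝ) :
    ∑ x ∈ P.powerset.sigma (fun S => S.powerset),
      (∏ p ∈ x.2, b p) * ∏ p ∈ x.1 \ x.2, a p = ∏ p ∈ P, (1 + (b p + a p)) := by
  rw [Finset.sum_sigma, Finset.prod_one_add]
  exact Finset.sum_congr rfl fun S _ => (Finset.prod_add b a S).symm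

/-- The numbers `∏ S` for the subsets `S` of `P` with `∑_{p ∈ S} g p ≤ A`. -/
noncomputable def weightedSmoothSet (P : Finset ℕ) (g : ℕ → ℝ) (A : ℝ) : Finset ℕ :=
  (P.powerset.filter fun S => ∑ p ∈ S, g p ≤ A).image fun S => ∏ p ∈ S, p

lemma sum_weightedSmoothSet {P : Finset ℕ} (hP : ∀ p ∈ P, p.Prime) {g : ℕ → ℝ} {A : ℝ}
    (h : ℕ → ℝ) :
    ∑ m ∈ weightedSmoothSet P g A, h m =
      ∑ S ∈ P.powerset.filter (fun S => ∑ p ∈ S, g p ≤ A), h (∏ p ∈ S, p) := by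
  rw [weightedSmoothSet, Finset.sum_image]
  intro S hS S' hS' hSS'
  have h1 : S ⊆ P := Finset.mem_powerset.1 (Finset.mem_filter.1 hS).1
  have h2 : S' ⊆ P := Finset.mem_powerset.1 (Finset.mem_filter.1 hS').1
  rw [← Nat.primeFactors_prod fun p hp => hP p (h1 hp),
    ← Nat.primeFactors_prod fun p hp => hP p (h2 hp)]
  exact congrArg _ hSS'

lemma weightedSmoothSet_pos {P : Finset ℕ} (hP : ∀ p ∈ P, p.Prime) {g : ℕ → ℝ} {A : ℝ}
    {m : ℕ} (hm : m ∈ weightedSmoothSet P g A) : 0 < m := by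
  obtain ⟨S, hS, rfl⟩ := Finset.mem_image.1 hm
  have h1 : S ⊆ P := Finset.mem_powerset.1 (Finset.mem_filter.1 hS).1
  exact Finset.prod_pos fun p hp => (hP p (h1 hp)).pos

/-- Rankin's trick: the indicator of $\sum g\le A$ is at most $e^{A-\sum g}$, and the sum of the
latter over all subsets factorizes. -/
lemma card_weightedSmoothSet_le {P : Finset ℕ} (hP : ∀ p ∈ P, p.Prime) {g : ℕ → ℝ} {A : ℝ} :
    ((weightedSmoothSet P g A).card : ℝ) ≤ Real.exp (A + ∑ p ∈ P, Real.exp (-g p)) := by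
  have h1 : ((weightedSmoothSet P g A).card : ℝ) = ∑ m ∈ weightedSmoothSet P g A, (1 : ℝ) := by
    simp
  rw [h1, sum_weightedSmoothSet hP]
  calc ∑ S ∈ P.powerset.filter (fun S => ∑ p ∈ S, g p ≤ A), (1 : ℝ)
      ≤ ∑ S ∈ P.powerset.filter (fun S => ∑ p ∈ S, g p ≤ A),
          Real.exp A * ∏ p ∈ S, Real.exp (-g p) := by
        refine Finset.sum_le_sum fun S hS => ?_
        rw [← Real.exp_sum, ← Real.exp_add, Finset.sum_neg_distrib]
        exact Real.one_le_exp (by linarith [(Finset.mem_filter.1 hS).2])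
    _ ≤ ∑ S ∈ P.powerset, Real.exp A * ∏ p ∈ S, Real.exp (-g p) :=
        Finset.sum_le_sum_of_subset_of_nonneg (Finset.filter_subset _ _) fun _ _ _ => by positivity
    _ = Real.exp A * ∏ p ∈ P, (1 + Real.exp (-g p)) := by
        rw [← Finset.mul_sum, Finset.prod_one_add]
    _ ≤ Real.exp A * Real.exp (∑ p ∈ P, Real.exp (-g p)) := by
        gcongr
        exact Real.prod_one_add_le_exp_sum _ fun p => (Real.exp_pos _).le
    _ = _ := by rw [Real.exp_add]

lemma sum_sq_weightedSmoothSet_le {P : Finset ℕ} (hP : ∀ p ∈ P, p.Prime) {f g : ℕ → ℝ} {A : ℝ} :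
    ∑ m ∈ weightedSmoothSet P g A, (∏ p ∈ m.primeFactors, f p) ^ 2 ≤
      ∏ p ∈ P, (1 + f p ^ 2) := by
  rw [sum_weightedSmoothSet hP, Finset.prod_one_add]
  calc _ ≤ ∑ S ∈ P.powerset.filter (fun S => ∑ p ∈ S, g p ≤ A), ∏ p ∈ S, f p ^ 2 := by
        refine Finset.sum_le_sum fun S hS => ?_
        have h1 : S ⊆ P := Finset.mem_powerset.1 (Finset.mem_filter.1 hS).1
        rw [Nat.primeFactors_prod fun p hp => hP p (h1 hp), Finset.prod_pow]
    _ ≤ _ := Finset.sum_le_sum_of_subset_of_nonneg (Finset.filter_subset _ _)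
        fun _ _ _ => by positivity

lemma one_mem_weightedSmoothSet {P : Finset ℕ} {g : ℕ → ℝ} {A : ℝ} (hA : 0 ≤ A) : 1 ∈ weightedSmoothSet P g A :=
  Finset.mem_image.2 ⟨∅, by simpa using hA, by simp⟩

/-- Lower bound for the resonance sum by the full sum over pairs `U ⊆ S ⊆ P` minus the
contributions of the pairs violating the weight or the size restriction. -/
lemma resonance_sum_lower_bound {P : Finset ℕ} (hP : ∀ p ∈ P, p.Prime) {f g : ℕ → ℝ} {A : ℝ}
    (hf : ∀ p ∈ P, 0 ≤ f p) (hg : ∀ p ∈ P, 0 ≤ g p)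
    {N : ℕ} {M₀ τ σ : ℝ} (hM₀ : 0 < M₀) (hN : M₀ ≤ N + 1) (hτ : 0 ≤ τ) (hσ : 0 ≤ σ) :
    ∏ p ∈ P, (1 + (f p / √p + f p ^ 2))
      - Real.exp (-(τ * A)) *
        ∏ p ∈ P, (1 + (f p / √p * Real.exp (τ * g p) + f p ^ 2 * Real.exp (τ * g p)))
      - M₀ ^ (-σ) * ∏ p ∈ P, (1 + (f p / √p * (p : ℝ) ^ σ + f p ^ 2)) ≤
    ∑ n ∈ Finset.Icc 1 N,
      ∑ m ∈ (weightedSmoothSet P g A).filter (fun m => m * n ∈ weightedSmoothSet P g A),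
        (∏ p ∈ m.primeFactors, f p) * (∏ p ∈ (m * n).primeFactors, f p) / √n := by
  set D := P.powerset.sigma (fun S : Finset ℕ => S.powerset) with hD
  have hDmem : ∀ x ∈ D, x.1 ⊆ P ∧ x.2 ⊆ x.1 := fun x hx => by
    rw [hD, Finset.mem_sigma, Finset.mem_powerset, Finset.mem_powerset] at hx
    exact hx
  set W : (Σ _ : Finset ℕ, Finset ℕ) → ℝ := fun x =>
    (∏ p ∈ x.2, f p / √p) * ∏ p ∈ x.1 \ x.2, f p ^ 2 with hW
  have hW0 : ∀ x ∈ D, 0 ≤ W x := fun x hx => by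
    refine mul_nonneg (Finset.prod_nonneg fun p hp => ?_) (Finset.prod_nonneg fun p _ => by positivity)
    have := hf p ((hDmem x hx).1 ((hDmem x hx).2 hp))
    positivity
  set G := D.filter fun x => ∑ p ∈ x.1, g p ≤ A ∧ ∏ p ∈ x.2, p ≤ N with hG
  have hGD : ∀ x ∈ G, x ∈ D := fun x hx => (Finset.mem_filter.1 hx).1
  have h1 : ∏ p ∈ P, (1 + (f p / √p + f p ^ 2))
      - Real.exp (-(τ * A)) *
        ∏ p ∈ P, (1 + (f p / √p * Real.exp (τ * g p) + f p ^ 2 * Real.exp (τ * g p)))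
      - M₀ ^ (-σ) * ∏ p ∈ P, (1 + (f p / √p * (p : ℝ) ^ σ + f p ^ 2)) ≤ ∑ x ∈ G, W x := by
    rw [← sum_sigma_powerset_prod_mul_prod, ← sum_sigma_powerset_prod_mul_prod,
      ← sum_sigma_powerset_prod_mul_prod, Finset.mul_sum, Finset.mul_sum,
      ← Finset.sum_sub_distrib, ← Finset.sum_sub_distrib, hG, Finset.sum_filter]
    refine Finset.sum_le_sum fun x hx => ?_
    obtain ⟨hx1, hx2⟩ := hDmem x hx
    have e1 : (∏ p ∈ x.2, f p / √p * Real.exp (τ * g p)) *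
        ∏ p ∈ x.1 \ x.2, f p ^ 2 * Real.exp (τ * g p) =
        W x * Real.exp (τ * ∑ p ∈ x.1, g p) := by
      have : Real.exp (τ * ∑ p ∈ x.1, g p) = (∏ p ∈ x.2, Real.exp (τ * g p)) *
          ∏ p ∈ x.1 \ x.2, Real.exp (τ * g p) := by
        rw [mul_comm (∏ p ∈ x.2, _), Finset.prod_sdiff hx2, Finset.mul_sum, Real.exp_sum]
      rw [this, Finset.prod_mul_distrib, Finset.prod_mul_distrib]
      ring
    have e2 : (∏ p ∈ x.2, f p / √p * (p : ℝ) ^ σ) * ∏ p ∈ x.1 \ x.2, f p ^ 2 =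
        W x * ((∏ p ∈ x.2, p : ℕ) : ℝ) ^ σ := by
      rw [Finset.prod_mul_distrib, Nat.cast_prod,
        ← Real.finsetProd_rpow _ _ fun p _ => Nat.cast_nonneg p]
      ring
    rw [e1, e2]
    have hWx := hW0 x hx
    have t1 : 0 ≤ Real.exp (-(τ * A)) * (W x * Real.exp (τ * ∑ p ∈ x.1, g p)) := by positivity
    have t2 : 0 ≤ M₀ ^ (-σ) * (W x * ((∏ p ∈ x.2, p : ℕ) : ℝ) ^ σ) := by positivity
    change W x - _ - _ ≤ _
    -- A discarded pair violates one of the two conditions, and the corresponding Rankin factor is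
    -- then at least $1$. For the size this uses that an integer exceeding $N$ is at least $N+1\ge
    -- M_0$.
    split_ifs with hc
    · linarith
    · rw [not_and_or, not_le, not_le] at hc
      rcases hc with hc | hc
      · have : W x ≤ Real.exp (-(τ * A)) * (W x * Real.exp (τ * ∑ p ∈ x.1, g p)) := by
          rw [mul_left_comm, ← Real.exp_add]
          refine le_mul_of_one_le_right hWx (Real.one_le_exp ?_)
          nlinarith
        linarith
      · have : W x ≤ M₀ ^ (-σ) * (W x * ((∏ p ∈ x.2, p : ℕ) : ℝ) ^ σ) := by
          rw [mul_left_comm]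
          refine le_mul_of_one_le_right hWx ?_
          rw [Real.rpow_neg hM₀.le, ← div_eq_inv_mul, ← Real.div_rpow (by positivity) hM₀.le]
          refine Real.one_le_rpow ?_ hσ
          rw [one_le_div hM₀]
          refine hN.trans ?_
          exact_mod_cast hc
        linarith
  refine h1.trans ?_
  -- The pair $(S,U)$ encodes $n=\prod U$ and $m=\prod(S\setminus U)$, so $mn=\prod S$ and its
  -- weight `W` is exactly $F(m)F(mn)/\sqrt n$. The remaining pairs $(n,m)$ contribute nonnegative
  -- terms.
  set φ : (Σ _ : Finset ℕ, Finset ℕ) → (Σ _ : ℕ, ℕ) := fun x =>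
    ⟨∏ p ∈ x.2, p, ∏ p ∈ x.1 \ x.2, p⟩ with hφ
  have hpf2 : ∀ x ∈ G, (∏ p ∈ x.2, p).primeFactors = x.2 := fun x hx =>
    Nat.primeFactors_prod fun p hp =>
      hP p ((hDmem x (hGD x hx)).1 ((hDmem x (hGD x hx)).2 hp))
  have hpf1 : ∀ x ∈ G, (∏ p ∈ x.1 \ x.2, p).primeFactors = x.1 \ x.2 := fun x hx =>
    Nat.primeFactors_prod fun p hp =>
      hP p ((hDmem x (hGD x hx)).1 (Finset.mem_sdiff.1 hp).1)
  have hpf : ∀ x ∈ G, (∏ p ∈ x.1, p).primeFactors = x.1 := fun x hx =>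
    Nat.primeFactors_prod fun p hp => hP p ((hDmem x (hGD x hx)).1 hp)
  have hmul : ∀ x ∈ G, (∏ p ∈ x.1 \ x.2, p) * ∏ p ∈ x.2, p = ∏ p ∈ x.1, p := fun x hx =>
    Finset.prod_sdiff (hDmem x (hGD x hx)).2
  have hinj : Set.InjOn φ G := by
    intro x hx x' hx' h
    rw [hφ] at h
    simp only [Sigma.mk.injEq, heq_eq_eq] at h
    have h2 : x.2 = x'.2 := by rw [← hpf2 x hx, ← hpf2 x' hx', h.1]
    have h3 : x.1 = x'.1 := by
      rw [← hpf x hx, ← hpf x' hx', ← hmul x hx, ← hmul x' hx', h.1, h.2]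
    exact Sigma.ext h3 (heq_of_eq h2)
  rw [Finset.sum_sigma']
  set F : (Σ _ : ℕ, ℕ) → ℝ := fun z =>
    (∏ p ∈ z.2.primeFactors, f p) * (∏ p ∈ (z.2 * z.1).primeFactors, f p) / √z.1 with hF
  have hWF : ∀ x ∈ G, W x = F (φ x) := by
    intro x hx
    simp only [hF, hφ, hW]
    rw [hmul x hx, hpf1 x hx, hpf x hx, ← Finset.prod_sdiff (hDmem x (hGD x hx)).2,
      Finset.prod_div_distrib, Finset.prod_pow]
    have : √((∏ p ∈ x.2, p : ℕ) : ℝ) = ∏ p ∈ x.2, √(p : ℝ) := by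
      rw [Nat.cast_prod, Real.sqrt_eq_rpow, ← Real.finsetProd_rpow _ _ fun p _ => Nat.cast_nonneg p]
      exact Finset.prod_congr rfl fun p _ => (Real.sqrt_eq_rpow _).symm
    rw [this]
    ring
  rw [Finset.sum_congr rfl hWF, ← Finset.sum_image hinj]
  refine Finset.sum_le_sum_of_subset_of_nonneg ?_ ?_
  · intro z hz
    obtain ⟨x, hx, rfl⟩ := Finset.mem_image.1 hz
    obtain ⟨hx1, hx2⟩ := hDmem x (hGD x hx)
    have hc := (Finset.mem_filter.1 hx).2
    rw [Finset.mem_sigma, Finset.mem_Icc, Finset.mem_filter]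
    refine ⟨⟨Finset.prod_pos fun p hp => (hP p (hx1 (hx2 hp))).pos, hc.2⟩, ?_, ?_⟩
    · refine Finset.mem_image.2 ⟨x.1 \ x.2, Finset.mem_filter.2 ⟨?_, ?_⟩, rfl⟩
      · exact Finset.mem_powerset.2 (Finset.sdiff_subset.trans hx1)
      · refine le_trans ?_ hc.1
        exact Finset.sum_le_sum_of_subset_of_nonneg Finset.sdiff_subset
          fun p hp _ => hg p (hx1 hp)
    · change (∏ p ∈ x.1 \ x.2, p) * ∏ p ∈ x.2, p ∈ _
      rw [hmul x hx]
      exact Finset.mem_image.2 ⟨x.1, Finset.mem_filter.2 ⟨Finset.mem_powerset.2 hx1, hc.1⟩, rfl⟩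
  · intro z hz _
    rw [Finset.mem_sigma, Finset.mem_filter] at hz
    have key : ∀ m ∈ weightedSmoothSet P g A, 0 ≤ ∏ p ∈ m.primeFactors, f p := by
      intro m hm
      obtain ⟨S, hS, rfl⟩ := Finset.mem_image.1 hm
      have hSP : S ⊆ P := Finset.mem_powerset.1 (Finset.mem_filter.1 hS).1
      rw [Nat.primeFactors_prod fun p hp => hP p (hSP hp)]
      exact Finset.prod_nonneg fun p hp => hf p (hSP hp)
    have k1 := key _ hz.2.1
    have k2 := key _ hz.2.2
    simp only [hF]
    positivity

/-! ### Comparison of Euler products. -/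

/-- Factorwise, $1+w'\le(1+w)(1+w'-w)\le(1+w)e^{w'-w}$. -/
lemma prod_one_add_le_mul_exp_sum_sub (P : Finset ℕ) (w w' : ℕ → ℝ) (h0 : ∀ p ∈ P, 0 ≤ w p)
    (h1 : ∀ p ∈ P, w p ≤ w' p) :
    ∏ p ∈ P, (1 + w' p) ≤ (∏ p ∈ P, (1 + w p)) * Real.exp (∑ p ∈ P, (w' p - w p)) := by
  rw [Real.exp_sum, ← Finset.prod_mul_distrib]
  refine Finset.prod_le_prod (fun p hp => by linarith [h0 p hp, h1 p hp]) fun p hp => ?_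
  have a0 := h0 p hp
  have a1 := h1 p hp
  have a2 := Real.add_one_le_exp (w' p - w p)
  nlinarith

/-- The gain of the resonator over $\sum F^2$. With $q=(1+a+b)/(1+a)$, $\log q\ge
1-1/q=b/(1+a+b)\ge(1-\varepsilon)b$. -/
lemma prod_one_add_mul_exp_le (P : Finset ℕ) (a b : ℕ → ℝ) {ε : ℝ} (hε : 0 ≤ ε)
    (ha : ∀ p ∈ P, 0 ≤ a p) (hb : ∀ p ∈ P, 0 ≤ b p) (hab : ∀ p ∈ P, b p + a p ≤ ε) :
    (∏ p ∈ P, (1 + a p)) * Real.exp ((1 - ε) * ∑ p ∈ P, b p) ≤ ∏ p ∈ P, (1 + (b p + a p)) := by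
  rw [Finset.mul_sum, Real.exp_sum, ← Finset.prod_mul_distrib]
  refine Finset.prod_le_prod (fun p hp => ?_) fun p hp => ?_
  · have := ha p hp
    positivity
  · have a0 := ha p hp
    have b0 := hb p hp
    have ab := hab p hp
    have hq : 0 < (1 + (b p + a p)) / (1 + a p) := by positivity
    have h1 : (1 - ε) * b p ≤ Real.log ((1 + (b p + a p)) / (1 + a p)) := by
      refine le_trans ?_ (Real.one_sub_inv_le_log_of_pos hq)
      have : 1 - ((1 + (b p + a p)) / (1 + a p))⁻¹ = b p * (1 / (1 + (b p + a p))) := by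
        field_simp
        ring
      rw [this, mul_comm]
      gcongr
      rw [le_div_iff₀ (by positivity)]
      nlinarith
    have h2 := (Real.le_log_iff_exp_le hq).1 h1
    rw [le_div_iff₀ (by positivity)] at h2
    linarith

/-- For $0\le t\le\varepsilon\le 1$ one has $e^t-1\le(1+\varepsilon)t$, so the Rankin twist costs
only $e^{(1+\varepsilon)\tau W}$. The tail is small once $A$ exceeds $(1+\varepsilon)W$. -/
lemma weight_tail_le (P : Finset ℕ) (a b g : ℕ → ℝ) (ha : ∀ p ∈ P, 0 ≤ a p)
    (hb : ∀ p ∈ P, 0 ≤ b p) (hg : ∀ p ∈ P, 0 ≤ g p) {ε τ W : ℝ} (hτ : 0 ≤ τ)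
    (hτg : ∀ p ∈ P, τ * g p ≤ ε) (hε0 : 0 ≤ ε) (hε1 : ε ≤ 1)
    (hW : ∑ p ∈ P, (b p + a p) * g p ≤ W) (A : ℝ) :
    Real.exp (-(τ * A)) *
        ∏ p ∈ P, (1 + (b p * Real.exp (τ * g p) + a p * Real.exp (τ * g p))) ≤
      (∏ p ∈ P, (1 + (b p + a p))) * Real.exp (-(τ * (A - (1 + ε) * W))) := by
  have hexp : ∀ p ∈ P, Real.exp (τ * g p) - 1 ≤ (1 + ε) * (τ * g p) := fun p hp => by
    have t0 : 0 ≤ τ * g p := mul_nonneg hτ (hg p hp)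
    have t1 := hτg p hp
    have t2 := (abs_le.1 (Real.abs_exp_sub_one_sub_id_le
      (abs_le.2 ⟨by linarith, by linarith⟩ : |τ * g p| ≤ 1))).2
    nlinarith
  have hprod := prod_one_add_le_mul_exp_sum_sub P (fun p => b p + a p)
    (fun p => b p * Real.exp (τ * g p) + a p * Real.exp (τ * g p))
    (fun p hp => add_nonneg (hb p hp) (ha p hp))
    (fun p hp => by
      have h1 : 1 ≤ Real.exp (τ * g p) := Real.one_le_exp (mul_nonneg hτ (hg p hp))
      have h2 := hb p hp
      have h3 := ha p hp
      nlinarith)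
  have hsum : ∑ p ∈ P, (b p * Real.exp (τ * g p) + a p * Real.exp (τ * g p)
      - (b p + a p)) ≤ (1 + ε) * τ * W := by
    calc _ ≤ ∑ p ∈ P, (1 + ε) * τ * ((b p + a p) * g p) := by
          refine Finset.sum_le_sum fun p hp => ?_
          have h1 := hexp p hp
          have h2 := hb p hp
          have h3 := ha p hp
          have : b p * Real.exp (τ * g p) + a p * Real.exp (τ * g p)
              - (b p + a p) = (b p + a p) * (Real.exp (τ * g p) - 1) := by
            ring
          rw [this]
          calc _ ≤ (b p + a p) * ((1 + ε) * (τ * g p)) := by gcongr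
            _ = _ := by ring
      _ = (1 + ε) * τ * ∑ p ∈ P, (b p + a p) * g p := by rw [← Finset.mul_sum]
      _ ≤ _ := by gcongr
  have h0 : 0 ≤ ∏ p ∈ P, (1 + (b p + a p)) := Finset.prod_nonneg fun p hp => by
    have h2 := hb p hp
    have h3 := ha p hp
    positivity
  calc _ ≤ Real.exp (-(τ * A)) *
        ((∏ p ∈ P, (1 + (b p + a p))) * Real.exp ((1 + ε) * τ * W)) := by
        gcongr
        refine hprod.trans ?_
        gcongr
    _ = _ := by
        rw [mul_left_comm, ← Real.exp_add]
        congr 2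
        ring

/-- The twist by $p^\sigma$ touches only the primes of $n$, that is the $b$ terms, and multiplies
each by at most $e$. -/
lemma size_tail_le (P : Finset ℕ) (a b : ℕ → ℝ) (ha : ∀ p ∈ P, 0 ≤ a p)
    (hb : ∀ p ∈ P, 0 ≤ b p) {σ : ℝ}
    (hpσ : ∀ p ∈ P, 1 ≤ (p : ℝ) ^ σ ∧ (p : ℝ) ^ σ ≤ Real.exp 1) {X : ℝ}
    (hX : ∑ p ∈ P, b p ≤ X) :
    ∏ p ∈ P, (1 + (b p * (p : ℝ) ^ σ + a p)) ≤
      (∏ p ∈ P, (1 + (b p + a p))) * Real.exp ((Real.exp 1 - 1) * X) := by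
  have he : 0 ≤ Real.exp 1 - 1 := by linarith [Real.add_one_le_exp (1 : ℝ)]
  refine (prod_one_add_le_mul_exp_sum_sub P (fun p => b p + a p)
    (fun p => b p * (p : ℝ) ^ σ + a p) (fun p hp => add_nonneg (hb p hp) (ha p hp))
    (fun p hp => by
      have h1 := (hpσ p hp).1
      have h2 := hb p hp
      nlinarith)).trans ?_
  have h0 : 0 ≤ ∏ p ∈ P, (1 + (b p + a p)) := Finset.prod_nonneg fun p hp => by
    have h2 := hb p hp
    have h3 := ha p hp
    positivity
  gcongr
  calc _ ≤ ∑ p ∈ P, (Real.exp 1 - 1) * b p := by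
        refine Finset.sum_le_sum fun p hp => ?_
        have h1 := (hpσ p hp).2
        have h2 := hb p hp
        nlinarith
    _ = (Real.exp 1 - 1) * ∑ p ∈ P, b p := by rw [← Finset.mul_sum]
    _ ≤ _ := by gcongr

/-! ### Choice of the parameters of the resonator. -/

lemma one_add_sq_add_le {ε : ℝ} (hε : 0 ≤ ε) : (1 + ε) ^ 2 + ε ≤ (1 + ε) ^ 3 := by
  nlinarith [mul_nonneg hε hε, mul_nonneg hε (mul_nonneg hε hε)]

lemma one_add_pow_five_add_le {ε : ℝ} (hε : 0 ≤ ε) : (1 + ε) ^ 5 + ε ≤ (1 + ε) ^ 6 := by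
  have : 1 ≤ (1 + ε) ^ 5 := one_le_pow₀ (by linarith)
  nlinarith

lemma exp_neg_le_two_div_sq {v : ℝ} (hv : 0 < v) : Real.exp (-v) ≤ 2 / v ^ 2 := by
  rw [Real.exp_neg, ← one_div, div_le_div_iff₀ (Real.exp_pos _) (by positivity)]
  have := Real.quadratic_le_exp_of_nonneg hv.le
  linarith

set_option maxHeartbeats 1000000 in
/-- The construction of the resonator, with all the requirements on the size of
`l = log T`, `x = log l` and `z = log x` made explicit. -/
lemma exists_resonator_of_bounds {ε s h l x z : ℝ} (hε0 : 0 < ε) (hε1 : ε ≤ 1 / 10)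
    (hs : s = (1 / 2 - ε) / (1 + ε) ^ 3) (hh0 : 0 ≤ h)
    (hh : Real.exp (-h) * (2 / ε ^ 2) ≤ ε * s ^ 2)
    (hl : 0 < l) (hx : 1 ≤ x) (hz : 1 ≤ z) (hlog : Real.log (l * x) = x + z)
    (H1 : h ≤ ε / 2 * z) (H2 : x ≤ ε * √l)
    (H3 : (1 + ε) * s * √(l * x * z) ≤ ε / 2 * s ^ 2 * l)
    (H4 : (1 + ε) * (ε * x) + h ≤ x)
    (H5 : Real.exp (-(ε * (1 + ε) ^ 4 * s ^ 2 * √l)) ≤ 1 / 4)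
    (H6 : z ≤ ε * x) (H7 : Real.exp (-(√(l * z / x) / 2)) ≤ 1 / 4)
    (H8 : s ^ 2 / z ≤ ε / 2) (H9 : 1 / √l ≤ ε / 2)
    (H10 : Real.log 2 ≤ ε * (1 - ε) ^ 2 * s * √(l * z / x))
    {P : Finset ℕ} {u : ℕ → ℝ} (hu : ∀ p, u p = Real.log p - Real.log (l * x))
    (hP : ∀ p ∈ P, p.Prime ∧ 1 ≤ u p ∧ u p ≤ ε * x)
    (hS1low : (1 - ε) * (z / x) ≤ ∑ p ∈ P, 1 / (p * u p))
    (hS1up : ∑ p ∈ P, 1 / (p * u p) ≤ (1 + ε) * (z / x))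
    (hS3 : ∑ p ∈ P, 1 / (p * u p ^ 2) ≤ 1 / x)
    {N : ℕ} (hN : Real.exp (Real.exp 1 * √(l * x * z / 2)) ≤ N + 1) :
    ∃ (S : Finset ℕ) (F : ℕ → ℝ), (∀ m ∈ S, 0 < m) ∧ (∀ m ∈ S, 0 ≤ F m) ∧
      0 < ∑ m ∈ S, F m ^ 2 ∧ (S.card : ℝ) ≤ Real.exp ((1 / 2 - ε) ^ 2 * l) ∧
      Real.exp (s * (1 - ε) ^ 3 * √(l * z / x)) * ∑ m ∈ S, F m ^ 2 ≤
        ∑ n ∈ Finset.Icc 1 N, ∑ m ∈ S.filter (fun m => m * n ∈ S), F m * F (m * n) / √n := by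
  obtain ⟨R, hR⟩ : ∃ R, R = √(l * z / x) := ⟨_, rfl⟩
  rw [← hR] at H7 H10 ⊢
  -- Since $\sum 1/(pu_p)\approx z/x$, this $\lambda$ gives $\lambda^2\sum 1/(pu_p)\approx s^2l$,
  -- the typical weight, and $\lambda\sum 1/(pu_p)\approx sR$, the gain.
  obtain ⟨lam, hlam⟩ : ∃ lam, lam = s * √(l * x / z) := ⟨_, rfl⟩
  obtain ⟨f, hf⟩ : ∃ f : ℕ → ℝ, ∀ p, f p = lam / (u p * √p) := ⟨_, fun _ => rfl⟩
  -- In the cardinality bound $e^{-u_p}=lx/p$; the extra $e^{-\varepsilon u_p}\le 2/(\varepsilon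
  -- u_p)^2$ brings in the sum of $1/(pu_p^2)$, and $e^{-h}$ beats the constant $2/\varepsilon^2$.
  obtain ⟨g, hg⟩ : ∃ g : ℕ → ℝ, ∀ p, g p = (1 + ε) * u p + h := ⟨_, fun _ => rfl⟩
  -- The mean weight is at most $(1+\varepsilon)^3s^2l$, and Rankin's trick costs one more factor
  -- $1+\varepsilon$. The fifth power leaves a margin, and the sixth is $(1/2-\varepsilon)^2l$ by
  -- the definition of $s$.
  obtain ⟨A, hA⟩ : ∃ A, A = s ^ 2 * l * (1 + ε) ^ 5 := ⟨_, rfl⟩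
  obtain ⟨S1, hS1⟩ : ∃ S1, S1 = ∑ p ∈ P, 1 / (p * u p) := ⟨_, rfl⟩
  obtain ⟨S3, hS3def⟩ : ∃ S3, S3 = ∑ p ∈ P, 1 / (p * u p ^ 2) := ⟨_, rfl⟩
  rw [← hS1] at hS1low hS1up
  rw [← hS3def] at hS3
  have hs0 : 0 < s := by rw [hs]; exact div_pos (by linarith) (by positivity)
  have hsε : s * (1 + ε) ^ 3 = 1 / 2 - ε := by rw [hs]; field_simp
  have hs1 : s * (1 + ε) ≤ 1 / 2 := by
    have : s * (1 + ε) ≤ s * (1 + ε) ^ 3 := by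
      gcongr
      exact le_self_pow₀ (by linarith) (by norm_num)
    linarith
  have hx0 : 0 < x := by linarith
  have hz0 : 0 < z := by linarith
  have hR0 : 0 ≤ R := hR ▸ Real.sqrt_nonneg _
  have hlam0 : 0 < lam := by rw [hlam]; positivity
  have hlam2 : lam ^ 2 = s ^ 2 * (l * x / z) := by
    rw [hlam, mul_pow, Real.sq_sqrt (by positivity)]
  have hPp : ∀ p ∈ P, p.Prime := fun p hp => (hP p hp).1
  have hu1 : ∀ p ∈ P, 1 ≤ u p := fun p hp => (hP p hp).2.1
  have hu2 : ∀ p ∈ P, u p ≤ ε * x := fun p hp => (hP p hp).2.2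
  have hp0 : ∀ p ∈ P, (0 : ℝ) < p := fun p hp => by exact_mod_cast (hPp p hp).pos
  have hf0 : ∀ p ∈ P, 0 ≤ f p := fun p hp => by
    have := hu1 p hp
    rw [hf]
    positivity
  have hg0 : ∀ p ∈ P, 0 ≤ g p := fun p hp => by
    have := hu1 p hp
    rw [hg]
    positivity
  have hgx : ∀ p ∈ P, g p ≤ x := fun p hp => by
    have : g p ≤ (1 + ε) * (ε * x) + h := by
      rw [hg]
      gcongr
      exact hu2 p hp
    linarith
  have hb : ∀ p ∈ P, f p / √p = lam * (1 / (p * u p)) := fun p hp => by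
    have h1 := hu1 p hp
    have h2 := hp0 p hp
    have h3 : 0 < √(p : ℝ) := Real.sqrt_pos.2 h2
    rw [hf, div_div, mul_assoc, Real.mul_self_sqrt h2.le]
    ring
  have ha : ∀ p ∈ P, f p ^ 2 = lam ^ 2 * (1 / (p * u p ^ 2)) := fun p hp => by
    rw [hf, div_pow, mul_pow, Real.sq_sqrt (hp0 p hp).le]
    ring
  have hb0 : ∀ p ∈ P, 0 ≤ f p / √p := fun p hp => div_nonneg (hf0 p hp) (Real.sqrt_nonneg _)
  have hsumb : ∑ p ∈ P, f p / √p = lam * S1 := by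
    rw [Finset.sum_congr rfl hb, ← Finset.mul_sum, hS1]
  have hsqrt1 : √(l * x / z) * (z / x) = R := by
    rw [hR, ← Real.sqrt_sq (show 0 ≤ z / x by positivity), ← Real.sqrt_mul (by positivity)]
    congr 1
    field_simp
  have hXup : lam * S1 ≤ s * (1 + ε) * R := by
    calc lam * S1 ≤ lam * ((1 + ε) * (z / x)) := by gcongr
      _ = s * (1 + ε) * (√(l * x / z) * (z / x)) := by rw [hlam]; ring
      _ = _ := by rw [hsqrt1]
  have hXlow : s * (1 - ε) * R ≤ lam * S1 := by
    calc s * (1 - ε) * R = s * (1 - ε) * (√(l * x / z) * (z / x)) := by rw [hsqrt1]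
      _ = lam * ((1 - ε) * (z / x)) := by rw [hlam]; ring
      _ ≤ lam * S1 := by gcongr
  have hS30 : 0 ≤ S3 := hS3def ▸ Finset.sum_nonneg fun p _ => by positivity
  have hRx : √(l * x * z) = R * x := by
    rw [hR, ← Real.sqrt_sq hx0.le, ← Real.sqrt_mul (by positivity), Real.sqrt_sq hx0.le]
    congr 1
    field_simp
  obtain ⟨Full, hFull⟩ : ∃ Full, Full = ∏ p ∈ P, (1 + (f p / √p + f p ^ 2)) := ⟨_, rfl⟩
  have hFull0 : 0 < Full := hFull ▸ Finset.prod_pos fun p hp => by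
    have := hb0 p hp
    positivity
  -- the weight restriction
  have hbad1 : Real.exp (-(1 / √l * A)) * ∏ p ∈ P, (1 + (f p / √p * Real.exp (1 / √l * g p)
      + f p ^ 2 * Real.exp (1 / √l * g p))) ≤ Full / 4 := by
    -- The scale $1/\sqrt l$ keeps $\tau g\le\varepsilon$, as $g\le x\le\varepsilon\sqrt l$, while
    -- $\tau l=\sqrt l$ still tends to infinity.
    obtain ⟨τ, hτ⟩ : ∃ τ, τ = 1 / √l := ⟨_, rfl⟩
    rw [← hτ]
    have hsl : 0 < √l := Real.sqrt_pos.2 hl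
    have hτ0 : 0 < τ := by rw [hτ]; positivity
    have hτl : τ * l = √l := by
      rw [hτ, one_div_mul_eq_div, Real.div_sqrt]
    have hτg : ∀ p ∈ P, τ * g p ≤ ε := fun p hp => by
      calc τ * g p ≤ τ * (ε * √l) := by
            gcongr
            exact (hgx p hp).trans H2
        _ = ε := by rw [hτ]; field_simp
    have hag : ∑ p ∈ P, f p ^ 2 * g p ≤ s ^ 2 * l * ((1 + ε) ^ 2 + ε / 2) := by
      have : ∑ p ∈ P, f p ^ 2 * g p = lam ^ 2 * ((1 + ε) * S1 + h * S3) := by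
        rw [hS1, hS3def, Finset.mul_sum, Finset.mul_sum, ← Finset.sum_add_distrib, Finset.mul_sum]
        refine Finset.sum_congr rfl fun p hp => ?_
        have h1 := hu1 p hp
        have h2 := hp0 p hp
        rw [ha p hp, hg]
        field_simp
      rw [this]
      calc lam ^ 2 * ((1 + ε) * S1 + h * S3)
          ≤ lam ^ 2 * ((1 + ε) * ((1 + ε) * (z / x)) + (ε / 2 * z) * (1 / x)) := by gcongr
        _ = _ := by rw [hlam2]; field_simp
    have hbg : ∑ p ∈ P, f p / √p * g p ≤ ε / 2 * s ^ 2 * l := by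
      calc ∑ p ∈ P, f p / √p * g p ≤ ∑ p ∈ P, f p / √p * x := by
            refine Finset.sum_le_sum fun p hp => ?_
            exact mul_le_mul_of_nonneg_left (hgx p hp) (hb0 p hp)
        _ = lam * S1 * x := by rw [← Finset.sum_mul, hsumb]
        _ ≤ s * (1 + ε) * R * x := by gcongr
        _ = (1 + ε) * s * √(l * x * z) := by rw [hRx]; ring
        _ ≤ _ := H3
    have hW : ∑ p ∈ P, (f p / √p + f p ^ 2) * g p ≤ (1 + ε) ^ 3 * s ^ 2 * l := by
      calc ∑ p ∈ P, (f p / √p + f p ^ 2) * g p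
          = ∑ p ∈ P, f p / √p * g p + ∑ p ∈ P, f p ^ 2 * g p := by
            rw [← Finset.sum_add_distrib]
            exact Finset.sum_congr rfl fun p _ => add_mul _ _ _
        _ ≤ ε / 2 * s ^ 2 * l + s ^ 2 * l * ((1 + ε) ^ 2 + ε / 2) := add_le_add hbg hag
        _ = ((1 + ε) ^ 2 + ε) * s ^ 2 * l := by ring
        _ ≤ _ := by
            gcongr ?_ * s ^ 2 * l
            exact one_add_sq_add_le hε0.le
    refine (weight_tail_le P (fun p => f p ^ 2) (fun p => f p / √p) g (fun p _ => sq_nonneg _)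
      hb0 hg0 hτ0.le hτg hε0.le (by linarith) hW A).trans ?_
    have hτA : τ * (A - (1 + ε) * ((1 + ε) ^ 3 * s ^ 2 * l)) =
        ε * (1 + ε) ^ 4 * s ^ 2 * √l := by
      rw [hA, ← hτl]; ring
    rw [hτA, div_eq_mul_one_div, ← hFull]
    gcongr
  -- the size restriction
  have hbad2 : Real.exp (Real.exp 1 * √(l * x * z / 2)) ^ (-(1 / ((1 + 2 * ε) * x))) *
      ∏ p ∈ P, (1 + (f p / √p * (p : ℝ) ^ (1 / ((1 + 2 * ε) * x)) + f p ^ 2)) ≤ Full / 4 := by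
    -- All primes of $P$ satisfy $\log p\le x+z+\varepsilon x\le(1+2\varepsilon)x$, so $p^\sigma\le
    -- e$.
    obtain ⟨σ, hσ⟩ : ∃ σ, σ = 1 / ((1 + 2 * ε) * x) := ⟨_, rfl⟩
    rw [← hσ]
    have hσ0 : 0 < σ := by rw [hσ]; positivity
    have hpσ : ∀ p ∈ P, 1 ≤ (p : ℝ) ^ σ ∧ (p : ℝ) ^ σ ≤ Real.exp 1 := fun p hp => by
      have h1 : (1 : ℝ) ≤ p := by exact_mod_cast (hPp p hp).one_lt.le
      refine ⟨Real.one_le_rpow h1 hσ0.le, ?_⟩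
      rw [Real.rpow_def_of_pos (hp0 p hp)]
      refine Real.exp_le_exp.2 ?_
      have h2 : Real.log p ≤ (1 + 2 * ε) * x := by
        have := (hP p hp).2.2
        rw [hu, hlog] at this
        linarith
      rw [hσ, mul_one_div, div_le_one (by positivity)]
      exact h2
    have hprod := size_tail_le P (fun p => f p ^ 2) (fun p => f p / √p) (fun p _ => sq_nonneg _)
      hb0 hpσ (hsumb.le.trans (hXup.trans (mul_le_mul_of_nonneg_right hs1 hR0)))
    rw [← hFull] at hprod
    have hM : Real.exp (Real.exp 1 * √(l * x * z / 2)) ^ (-σ) ≤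
        Real.exp (-(R * (Real.exp 1 * (58 / 100)))) := by
      rw [← Real.exp_mul]
      refine Real.exp_le_exp.2 ?_
      have h1 : √(l * x * z / 2) = R * x / √2 := by
        rw [Real.sqrt_div (by positivity), hRx]
      have h2 : √2 ≤ 1.4143 := by
        rw [Real.sqrt_le_left (by norm_num)]; norm_num
      -- Any constant above $(e-1)/(2e)$ would do: the twist costs at most $e^{(e-1)R/2}$, and
      -- $0.58$ leaves a saving of more than $e^{-R/2}$.
      have h3 : (58 / 100 : ℝ) ≤ 1 / (√2 * (1 + 2 * ε)) := by
        rw [le_div_iff₀ (by positivity)]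
        have : √2 * (1 + 2 * ε) ≤ 1.4143 * 1.2 := by
          gcongr
          linarith
        nlinarith
      have h4 : Real.exp 1 * √(l * x * z / 2) * (-σ)
          = -(R * (Real.exp 1 * (1 / (√2 * (1 + 2 * ε))))) := by
        rw [h1, hσ]
        field_simp
      rw [h4]
      gcongr
    calc _ ≤ Real.exp (-(R * (Real.exp 1 * (58 / 100)))) *
          (Full * Real.exp ((Real.exp 1 - 1) * (1 / 2 * R))) := by
          refine mul_le_mul hM hprod (Finset.prod_nonneg fun p hp => ?_)
            (Real.exp_pos _).le
          have := hb0 p hp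
          positivity
      _ = Full * Real.exp (-(R * (Real.exp 1 * (8 / 100) + 1 / 2))) := by
          rw [mul_left_comm, ← Real.exp_add]
          congr 2
          ring
      _ ≤ Full * Real.exp (-(R / 2)) := by
          gcongr
          have : 0 ≤ R * (Real.exp 1 * (8 / 100)) := by positivity
          linarith
      _ ≤ Full * (1 / 4) := by gcongr
      _ = _ := by ring
  have hmain := resonance_sum_lower_bound hPp hf0 hg0 (A := A) (N := N) (Real.exp_pos _) hN
    (show 0 ≤ 1 / √l by positivity) (show 0 ≤ 1 / ((1 + 2 * ε) * x) by positivity)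
  -- As $u_p\ge 1$ and $p\ge lx$, each Euler factor is within $\varepsilon$ of $1$, so taking
  -- logarithms loses only a factor $1-\varepsilon$.
  have hab : ∀ p ∈ P, f p / √p + f p ^ 2 ≤ ε := fun p hp => by
    have h1 := hu1 p hp
    have h2 : l * x ≤ p := by
      have : Real.log (l * x) ≤ Real.log p := by
        have := (hP p hp).2.1
        rw [hu] at this
        linarith
      exact (Real.log_le_log_iff (by positivity) (hp0 p hp)).1 this
    have hsl : 0 < √l := Real.sqrt_pos.2 hl
    have hlx : 0 < l * x := by positivity
    have h3 : l * x ≤ p * u p := h2.trans (le_mul_of_one_le_right (hp0 p hp).le h1)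
    have h4 : l * x ≤ p * u p ^ 2 :=
      h2.trans (le_mul_of_one_le_right (hp0 p hp).le (one_le_pow₀ h1))
    have h5 : lam ≤ √l * x := by
      have e1 : l * x / z ≤ l * x ^ 2 := by
        calc l * x / z ≤ l * x / 1 := by gcongr
          _ = l * x ^ 1 := by rw [div_one, pow_one]
          _ ≤ l * x ^ 2 := by gcongr; norm_num
      have e2 : √(l * x / z) ≤ √l * x := by
        calc √(l * x / z) ≤ √(l * x ^ 2) := Real.sqrt_le_sqrt e1
          _ = √l * x := by rw [Real.sqrt_mul hl.le, Real.sqrt_sq hx0.le]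
      have e3 : s ≤ 1 :=
        (le_mul_of_one_le_right hs0.le (by linarith)).trans (hs1.trans (by norm_num))
      calc lam ≤ 1 * (√l * x) := by rw [hlam]; gcongr
        _ = _ := one_mul _
    have h6 : f p / √p ≤ ε / 2 := by
      rw [hb p hp]
      calc lam * (1 / (p * u p)) ≤ √l * x * (1 / (l * x)) := by gcongr
        _ = 1 / √l := by
            field_simp
            exact Real.sq_sqrt hl.le
        _ ≤ _ := H9
    have h7 : f p ^ 2 ≤ ε / 2 := by
      rw [ha p hp]
      calc lam ^ 2 * (1 / (p * u p ^ 2)) ≤ lam ^ 2 * (1 / (l * x)) := by gcongr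
        _ = s ^ 2 / z := by rw [hlam2]; field_simp
        _ ≤ _ := H8
    linarith
  have hFlow := prod_one_add_mul_exp_le P (fun p => f p ^ 2) (fun p => f p / √p) hε0.le
    (fun p _ => sq_nonneg _) hb0 hab
  rw [hsumb, ← hFull] at hFlow
  rw [← hFull] at hmain
  refine ⟨weightedSmoothSet P g A, fun m => ∏ p ∈ m.primeFactors, f p,
    fun m hm => weightedSmoothSet_pos hPp hm, ?_, ?_, ?_, ?_⟩
  · intro m hm
    obtain ⟨S, hS, rfl⟩ := Finset.mem_image.1 hm
    have hSP : S ⊆ P := Finset.mem_powerset.1 (Finset.mem_filter.1 hS).1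
    change 0 ≤ ∏ p ∈ (∏ p ∈ S, p).primeFactors, f p
    rw [Nat.primeFactors_prod fun p hp => hPp p (hSP hp)]
    exact Finset.prod_nonneg fun p hp => hf0 p (hSP hp)
  · refine Finset.sum_pos' (fun m _ => sq_nonneg _)
      ⟨1, one_mem_weightedSmoothSet (by rw [hA]; positivity), by simp⟩
  · refine (card_weightedSmoothSet_le hPp).trans (Real.exp_le_exp.2 ?_)
    have h1 : ∑ p ∈ P, Real.exp (-g p) ≤ ε * s ^ 2 * l := by
      calc ∑ p ∈ P, Real.exp (-g p)
          ≤ ∑ p ∈ P, Real.exp (-h) * (2 / ε ^ 2) * (l * x) * (1 / (p * u p ^ 2)) := by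
            refine Finset.sum_le_sum fun p hp => ?_
            have a1 := hu1 p hp
            have a2 := hp0 p hp
            have a3 : Real.exp (-u p) = l * x / p := by
              rw [hu, neg_sub, Real.exp_sub, Real.exp_log (by positivity), Real.exp_log a2]
            have a4 : Real.exp (-(ε * u p)) ≤ 2 / (ε * u p) ^ 2 :=
              exp_neg_le_two_div_sq (by positivity)
            calc Real.exp (-g p) = Real.exp (-h) * (Real.exp (-u p) * Real.exp (-(ε * u p))) := by
                  rw [← Real.exp_add, ← Real.exp_add]
                  congr 1
                  rw [hg]
                  ring
              _ ≤ Real.exp (-h) * (l * x / p * (2 / (ε * u p) ^ 2)) := by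
                  rw [a3]
                  gcongr
              _ = _ := by field_simp
        _ = Real.exp (-h) * (2 / ε ^ 2) * (l * x) * S3 := by rw [← Finset.mul_sum, hS3def]
        _ ≤ ε * s ^ 2 * (l * x) * (1 / x) := by gcongr
        _ = _ := by field_simp
    have h2 : (1 / 2 - ε) ^ 2 * l = s ^ 2 * l * (1 + ε) ^ 6 := by rw [← hsε]; ring
    rw [h2]
    calc A + ∑ p ∈ P, Real.exp (-g p) ≤ s ^ 2 * l * (1 + ε) ^ 5 + ε * s ^ 2 * l :=
          add_le_add hA.le h1
      _ = s ^ 2 * l * ((1 + ε) ^ 5 + ε) := by ring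
      _ ≤ _ := by
        gcongr
        exact one_add_pow_five_add_le hε0.le
  · calc _ ≤ Real.exp (s * (1 - ε) ^ 3 * R) * ∏ p ∈ P, (1 + f p ^ 2) := by
          gcongr
          exact sum_sq_weightedSmoothSet_le hPp
      -- The two tails take at most half of `Full`; the resulting factor $2$ is absorbed by giving
      -- up one factor $1-\varepsilon$ in the exponent, by `H10`.
      _ ≤ Real.exp ((1 - ε) * (lam * S1)) / 2 * ∏ p ∈ P, (1 + f p ^ 2) := by
          gcongr
          rw [le_div_iff₀ (by norm_num)]
          calc Real.exp (s * (1 - ε) ^ 3 * R) * 2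
              = Real.exp (s * (1 - ε) ^ 3 * R + Real.log 2) := by
                rw [Real.exp_add, Real.exp_log (by norm_num)]
            _ ≤ Real.exp ((1 - ε) * (lam * S1)) := by
                refine Real.exp_le_exp.2 ?_
                calc s * (1 - ε) ^ 3 * R + Real.log 2
                    ≤ s * (1 - ε) ^ 3 * R + ε * (1 - ε) ^ 2 * s * R := by gcongr
                  _ = (1 - ε) * (s * (1 - ε) * R) := by ring
                  _ ≤ _ := by
                      gcongr
                      linarith
      _ ≤ Full / 2 := by linarith
      _ ≤ _ := by linarith

/-- For large `l = log T` there is a resonator with at most `exp ((1/2-ε)^2 l)` frequencies. -/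
lemma eventually_exists_resonator {ε s : ℝ} (hε0 : 0 < ε) (hε1 : ε ≤ 1 / 10)
    (hs : s = (1 / 2 - ε) / (1 + ε) ^ 3) :
    ∀ᶠ l : ℝ in atTop, ∀ N : ℕ,
      Real.exp (Real.exp 1 * √(l * Real.log l * Real.log (Real.log l) / 2)) ≤ N + 1 →
      ∃ (S : Finset ℕ) (F : ℕ → ℝ), (∀ m ∈ S, 0 < m) ∧ (∀ m ∈ S, 0 ≤ F m) ∧
        0 < ∑ m ∈ S, F m ^ 2 ∧ (S.card : ℝ) ≤ Real.exp ((1 / 2 - ε) ^ 2 * l) ∧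
        Real.exp (s * (1 - ε) ^ 3 * √(l * Real.log (Real.log l) / Real.log l)) *
          ∑ m ∈ S, F m ^ 2 ≤
        ∑ n ∈ Finset.Icc 1 N, ∑ m ∈ S.filter (fun m => m * n ∈ S), F m * F (m * n) / √n := by
  have hs0 : 0 < s := by rw [hs]; exact div_pos (by linarith) (by positivity)
  have hs1 : s ≤ 1 := by
    rw [hs, div_le_one (by positivity)]
    have : 1 ≤ (1 + ε) ^ 3 := one_le_pow₀ (by linarith)
    linarith
  set h := max 0 (Real.log (2 / ε ^ 2 / (ε * s ^ 2))) with hh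
  have hh0 : 0 ≤ h := le_max_left _ _
  have hhexp : Real.exp (-h) * (2 / ε ^ 2) ≤ ε * s ^ 2 := by
    have h1 : 2 / ε ^ 2 / (ε * s ^ 2) ≤ Real.exp h := by
      rw [← Real.exp_log (show 0 < 2 / ε ^ 2 / (ε * s ^ 2) by positivity)]
      exact Real.exp_le_exp.2 (le_max_right _ _)
    rw [div_le_iff₀ (by positivity)] at h1
    rw [Real.exp_neg, ← div_eq_inv_mul, div_le_iff₀ (Real.exp_pos _)]
    linarith
  set c := ε * s ^ 2 / 4 with hc
  have hc0 : 0 < c := by positivity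
  -- facts about `z = log x` as `x → ∞`
  have hlog := Real.tendsto_log_atTop
  have e1 : ∀ᶠ x : ℝ in atTop, Real.log x ≤ c * x := by
    have h2 := Real.isLittleO_log_id_atTop.bound hc0
    filter_upwards [h2, eventually_gt_atTop 1] with x hx hx0
    rw [id, Real.norm_of_nonneg (Real.log_nonneg hx0.le), Real.norm_of_nonneg (by linarith)] at hx
    exact hx
  have e2 : ∀ᶠ x : ℝ in atTop, max 1 (max (2 * h / ε) (2 / ε)) ≤ Real.log x :=
    hlog.eventually_ge_atTop _
  have e3 : ∀ᶠ x : ℝ in atTop, max 1 (2 * h) ≤ x := eventually_ge_atTop _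
  -- facts about `x = log l` as `l → ∞`
  have e4 : ∀ᶠ l : ℝ in atTop, Real.log l ≤ c * √l := by
    have h2 := (isLittleO_log_rpow_atTop (show (0 : ℝ) < 1 / 2 by norm_num)).bound hc0
    filter_upwards [h2, eventually_gt_atTop 1] with x hx hx0
    rw [Real.norm_of_nonneg (Real.log_nonneg hx0.le), Real.norm_of_nonneg (by positivity),
      ← Real.sqrt_eq_rpow] at hx
    exact hx
  have hsqrt : Tendsto (fun l : ℝ => √l) atTop atTop := Real.tendsto_sqrt_atTop
  have e5 : ∀ᶠ l : ℝ in atTop, max (2 / ε) (max (Real.log 4 / (ε * (1 + ε) ^ 4 * s ^ 2))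
      (max ((2 * Real.log 4) ^ 2) ((Real.log 2 / (ε * (1 - ε) ^ 2 * s)) ^ 2))) ≤ √l :=
    hsqrt.eventually_ge_atTop _
  filter_upwards [eventually_exists_primes ε hε0 (by linarith),
    hlog.eventually (e1.and (e2.and e3)), e4, e5, eventually_ge_atTop 1] with l hprimes hx he4 he5 hl1
  obtain ⟨hx1, hx2, hx3⟩ := hx
  obtain ⟨x, hxdef⟩ : ∃ x, x = Real.log l := ⟨_, rfl⟩
  rw [← hxdef] at hprimes hx1 hx2 hx3 he4 ⊢
  obtain ⟨z, hzdef⟩ : ∃ z, z = Real.log x := ⟨_, rfl⟩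
  rw [← hzdef] at hprimes hx1 hx2 ⊢
  simp only [max_le_iff] at hx2 hx3 he5
  obtain ⟨hz1, hz2, hz3⟩ := hx2
  obtain ⟨hx1', hxh⟩ := hx3
  obtain ⟨hq1, hq2, hq3, hq4⟩ := he5
  have hl0 : 0 < l := by linarith
  have hx0 : 0 < x := by linarith
  have hz0 : 0 < z := by linarith
  have hsl : 0 < √l := Real.sqrt_pos.2 hl0
  have hsl2 : √l * √l = l := Real.mul_self_sqrt hl0.le
  have hc1 : c ≤ ε := by
    have : s ^ 2 ≤ 1 := pow_le_one₀ hs0.le hs1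
    nlinarith
  have hc1' : c ≤ 1 := by linarith
  have hzx : z ≤ x := by nlinarith
  -- Because $x\le c\sqrt l$ with $c\le 1$, the gain exponent is at least $l^{1/4}$, hence exceeds
  -- any constant.
  have hR : √(√l) ≤ √(l * z / x) := by
    refine Real.sqrt_le_sqrt ?_
    rw [le_div_iff₀ hx0]
    calc √l * x ≤ √l * (c * √l) := by gcongr
      _ = c * l := by rw [mul_left_comm, hsl2]
      _ ≤ 1 * l := by gcongr
      _ ≤ z * l := by gcongr
      _ = l * z := mul_comm _ _
  have hRge : ∀ q : ℝ, q ^ 2 ≤ √l → q ≤ √(l * z / x) := fun q hq =>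
    (Real.le_sqrt_of_sq_le hq).trans hR
  intro N hN
  obtain ⟨P, hP1, hP2, hP3, hP4⟩ := hprimes
  refine exists_resonator_of_bounds hε0 hε1 hs hh0 hhexp hl0 hx1' hz1 ?_ ?_ ?_ ?_ ?_ ?_ ?_ ?_ ?_ ?_
    ?_ (fun p => rfl) hP1 hP2 hP3 hP4 hN
  · rw [Real.log_mul hl0.ne' hx0.ne', ← hxdef, ← hzdef]
  · rw [div_le_iff₀ hε0] at hz2
    linarith
  · exact he4.trans (by gcongr)
  · have h1 : √(l * x * z) ≤ c * l := by
      rw [Real.sqrt_le_left (by positivity)]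
      calc l * x * z ≤ l * (c * √l) * (c * √l) := by
            gcongr
            exact hzx.trans he4
        _ = c ^ 2 * l * (√l * √l) := by ring
        _ = (c * l) ^ 2 := by rw [hsl2]; ring
    calc (1 + ε) * s * √(l * x * z) ≤ 2 * 1 * (c * l) := by
          gcongr
          linarith
      _ = _ := by rw [hc]; ring
  · have h1 : (1 + ε) * ε ≤ 1 / 2 := by nlinarith
    have h2 : (1 + ε) * ε * x ≤ 1 / 2 * x := by gcongr
    linarith
  · have : Real.log 4 ≤ ε * (1 + ε) ^ 4 * s ^ 2 * √l := by
      rw [div_le_iff₀ (by positivity)] at hq2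
      linarith
    calc _ ≤ Real.exp (-Real.log 4) := Real.exp_le_exp.2 (by linarith)
      _ = 1 / 4 := by rw [Real.exp_neg, Real.exp_log (by norm_num)]; norm_num
  · exact hx1.trans (by gcongr)
  · have := hRge _ hq3
    calc _ ≤ Real.exp (-Real.log 4) := Real.exp_le_exp.2 (by linarith)
      _ = 1 / 4 := by rw [Real.exp_neg, Real.exp_log (by norm_num)]; norm_num
  · have h1 : s ^ 2 ≤ 1 := pow_le_one₀ hs0.le hs1
    rw [div_le_iff₀ hε0] at hz3
    rw [div_le_iff₀ hz0]
    linarith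
  · rw [div_le_iff₀ hε0] at hq1
    rw [div_le_iff₀ hsl]
    linarith
  · have h1 : 0 < ε * (1 - ε) ^ 2 * s := by
      have : 0 < 1 - ε := by linarith
      positivity
    have h2 := hRge _ hq4
    rw [div_le_iff₀ h1] at h2
    linarith

/-! ### Pointwise bounds for the Dirichlet polynomial. -/

lemma norm_natCast_cpow_half (n : ℕ) (hn : 0 < n) (t : ℝ) :
    ‖(n : ℂ) ^ (-(1 / 2 : ℂ) - Complex.I * (t : ℂ))‖ = 1 / √n := by
  rw [Complex.norm_natCast_cpow_of_pos hn]
  have : (-(1 / 2 : ℂ) - Complex.I * (t : ℂ)).re = -(1 / 2) := by simp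
  rw [this, Real.rpow_neg (Nat.cast_nonneg n), ← Real.sqrt_eq_rpow, one_div]

lemma sum_Icc_one_div_sqrt_le (N : ℕ) : ∑ n ∈ Finset.Icc 1 N, 1 / √(n : ℝ) ≤ 2 * √N := by
  induction N with
  | zero => simp
  | succ n ih =>
    rw [Finset.sum_Icc_succ_top (by omega)]
    have h1 : 0 < √((n + 1 : ℕ) : ℝ) := Real.sqrt_pos.2 (by positivity)
    have h2 : √((n + 1 : ℕ) : ℝ) ^ 2 = n + 1 := by
      rw [Real.sq_sqrt (by positivity)]; push_cast; ring
    have h3 : √(n : ℝ) ^ 2 = n := Real.sq_sqrt (Nat.cast_nonneg n)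
    have h4 : 1 / √((n + 1 : ℕ) : ℝ) ≤ 2 * √((n + 1 : ℕ) : ℝ) - 2 * √(n : ℝ) := by
      rw [div_le_iff₀ h1]
      nlinarith [sq_nonneg (√((n + 1 : ℕ) : ℝ) - √(n : ℝ))]
    linarith

/-- Trivial bound for the Dirichlet polynomial. -/
lemma norm_dirichletPartialSum_le (M t : ℝ) : ‖dirichletPartialSum M t‖ ≤ 2 * √(⌊M⌋₊ : ℝ) := by
  refine (norm_sum_le _ _).trans ?_
  rw [Finset.sum_congr rfl fun n hn => norm_natCast_cpow_half n (Finset.mem_Icc.1 hn).1 t]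
  exact sum_Icc_one_div_sqrt_le _

lemma continuous_dirichletPartialSum (M : ℝ) : Continuous (dirichletPartialSum M) := by
  unfold dirichletPartialSum
  refine continuous_finsetSum _ fun n hn => ?_
  have : (n : ℂ) ≠ 0 := by
    have := (Finset.mem_Icc.1 hn).1
    exact_mod_cast (by omega : n ≠ 0)
  exact Continuous.const_cpow (by fun_prop) (Or.inl this)

/-- Telescoping comparison for `∑ n^{-3/2}`. -/
lemma one_div_rpow_three_halves_le (n : ℕ) (hn : 1 ≤ n) :
    (n : ℝ) ^ (-(3 / 2) : ℝ) ≤ 4 * (1 / √(n : ℝ) - 1 / √((n + 1 : ℕ) : ℝ)) := by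
  have hn0 : (1 : ℝ) ≤ n := by exact_mod_cast hn
  set a := √(n : ℝ) with ha
  set b := √((n + 1 : ℕ) : ℝ) with hb
  have ha0 : 0 < a := Real.sqrt_pos.2 (by linarith)
  have hb0 : 0 < b := Real.sqrt_pos.2 (by positivity)
  have ha2 : a ^ 2 = n := Real.sq_sqrt (by linarith)
  have hb2 : b ^ 2 = n + 1 := by rw [hb, Real.sq_sqrt (by positivity)]; push_cast; ring
  have h1 : (n : ℝ) ^ (-(3 / 2) : ℝ) = 1 / a ^ 3 := by
    rw [Real.rpow_neg (by linarith), ha, Real.sqrt_eq_rpow, ← Real.rpow_natCast, ← Real.rpow_mul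
      (by linarith), one_div]
    norm_num
  have hba : b ≤ 3 / 2 * a := by
    refine abs_le_of_sq_le_sq' ?_ (by positivity) |>.2
    nlinarith
  have hab : a ≤ b := Real.sqrt_le_sqrt (by push_cast; linarith)
  have h2 : (b - a) * (b + a) = 1 := by nlinarith
  have h3 : 1 / a - 1 / b = 1 / (a * b * (b + a)) := by
    field_simp
    linarith
  rw [h1, h3, mul_one_div, div_le_div_iff₀ (by positivity) (by positivity)]
  have : b * (b + a) ≤ (3 / 2 * a) * (3 / 2 * a + a) := by gcongr
  nlinarith [mul_le_mul_of_nonneg_left this ha0.le, pow_pos ha0 3]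

/-- One Euler–Maclaurin step. -/
lemma norm_cpow_div_sub_sub_le (n : ℕ) (hn : 1 ≤ n) (t : ℝ) :
    ‖((n + 1 : ℕ) : ℂ) ^ (1 / 2 - Complex.I * t : ℂ) / (1 / 2 - Complex.I * t)
      - (n : ℂ) ^ (1 / 2 - Complex.I * t : ℂ) / (1 / 2 - Complex.I * t)
      - ((n + 1 : ℕ) : ℂ) ^ (-(1 / 2 : ℂ) - Complex.I * t)‖ ≤
    (1 / 2 + |t|) * (n : ℝ) ^ (-(3 / 2) : ℝ) := by
  have hn0 : (0 : ℝ) < n := by exact_mod_cast hn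
  set w : ℂ := 1 / 2 - Complex.I * t with hw
  have hw0 : w ≠ 0 := by
    intro h
    have := congrArg Complex.re h
    simp [hw] at this
  set v : ℂ := -(1 / 2 : ℂ) - Complex.I * t with hv
  have hwv : w - 1 = v := by rw [hw, hv]; ring
  have hvnorm : ‖v‖ ≤ 1 / 2 + |t| := by
    rw [hv]
    refine (norm_sub_le _ _).trans ?_
    rw [norm_neg, norm_mul, Complex.norm_I, one_mul, Complex.norm_real, Real.norm_eq_abs]
    norm_num
  have hderivv : ∀ x ∈ Set.Icc (n : ℝ) (n + 1), HasDerivWithinAt (fun y : ℝ => (y : ℂ) ^ v)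
      (v * (x : ℂ) ^ (v - 1)) (Set.Icc (n : ℝ) (n + 1)) x := by
    intro x hx
    have hx0 : 0 < x := lt_of_lt_of_le hn0 hx.1
    have := (hasDerivAt_id (x : ℂ)).cpow_const (c := v) (Or.inl (by simpa using hx0))
    simpa using this.comp_ofReal.hasDerivWithinAt
  have hbv : ∀ x ∈ Set.Icc (n : ℝ) (n + 1),
      ‖v * (x : ℂ) ^ (v - 1)‖ ≤ (1 / 2 + |t|) * (n : ℝ) ^ (-(3 / 2) : ℝ) := by
    intro x hx
    have hx0 : 0 < x := lt_of_lt_of_le hn0 hx.1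
    rw [norm_mul, Complex.norm_cpow_eq_rpow_re_of_pos hx0]
    have : (v - 1).re = -(3 / 2) := by simp [hv]; norm_num
    rw [this]
    gcongr ?_ * ?_
    exact Real.rpow_le_rpow_of_nonpos hn0 hx.1 (by norm_num)
  have hdiff : ∀ x ∈ Set.Icc (n : ℝ) (n + 1),
      ‖(x : ℂ) ^ v - ((n + 1 : ℝ) : ℂ) ^ v‖ ≤ (1 / 2 + |t|) * (n : ℝ) ^ (-(3 / 2) : ℝ) := by
    intro x hx
    have := (convex_Icc (n : ℝ) (n + 1)).norm_image_sub_le_of_norm_hasDerivWithin_le hderivv hbv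
      (Set.right_mem_Icc.2 (by linarith)) hx
    refine this.trans (mul_le_of_le_one_right (by positivity) ?_)
    rw [Real.norm_eq_abs, abs_le]
    constructor <;> linarith [hx.1, hx.2]
  -- This function has derivative $x^v-(n+1)^v$, already bounded by `hdiff`; its increment over
  -- $[n,n+1]$ is the quantity to estimate.
  have hderiv2 : ∀ x ∈ Set.Icc (n : ℝ) (n + 1),
      HasDerivWithinAt (fun y : ℝ => (y : ℂ) ^ w / w - (y : ℂ) * ((n + 1 : ℝ) : ℂ) ^ v)
      ((x : ℂ) ^ v - ((n + 1 : ℝ) : ℂ) ^ v) (Set.Icc (n : ℝ) (n + 1)) x := by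
    intro x hx
    have hx0 : 0 < x := lt_of_lt_of_le hn0 hx.1
    have h1 := ((hasDerivAt_id (x : ℂ)).cpow_const (c := w)
      (Or.inl (by simpa using hx0))).div_const w
    have h2 := (hasDerivAt_id (x : ℂ)).mul_const (((n + 1 : ℝ) : ℂ) ^ v)
    have h3 := (h1.sub h2).comp_ofReal.hasDerivWithinAt (s := Set.Icc (n : ℝ) (n + 1))
    refine (h3.congr_deriv ?_)
    rw [hwv, id]
    field_simp
  have h := (convex_Icc (n : ℝ) (n + 1)).norm_image_sub_le_of_norm_hasDerivWithin_le hderiv2 hdiff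
      (Set.left_mem_Icc.2 (by linarith)) (Set.right_mem_Icc.2 (by linarith))
  have e1 : ‖(n : ℝ) + 1 - n‖ = 1 := by norm_num
  rw [e1, mul_one] at h
  refine le_trans (le_of_eq ?_) h
  congr 1
  push_cast
  ring

/-- Euler–Maclaurin: comparison of a partial sum with the integral. -/
lemma norm_dirichletPartialSum_sub_sub_le (t : ℝ) (K N : ℕ) (hK : 1 ≤ K) (hKN : K ≤ N) :
    ‖(N : ℂ) ^ (1 / 2 - Complex.I * t : ℂ) / (1 / 2 - Complex.I * t)
      - (K : ℂ) ^ (1 / 2 - Complex.I * t : ℂ) / (1 / 2 - Complex.I * t)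
      - (dirichletPartialSum N t - dirichletPartialSum K t)‖ ≤
    (1 / 2 + |t|) * (4 * (1 / √(K : ℝ) - 1 / √(N : ℝ))) := by
  induction N, hKN using Nat.le_induction with
  | base => simp
  | succ n hn ih =>
    have h1 := norm_cpow_div_sub_sub_le n (hK.trans hn) t
    have h2 := one_div_rpow_three_halves_le n (hK.trans hn)
    have h3 : dirichletPartialSum (n + 1 : ℕ) t = dirichletPartialSum n t +
        ((n + 1 : ℕ) : ℂ) ^ (-(1 / 2 : ℂ) - Complex.I * t) := by
      rw [dirichletPartialSum, dirichletPartialSum, Nat.floor_natCast, Nat.floor_natCast,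
        Finset.sum_Icc_succ_top (by omega)]
    have h4 : (0 : ℝ) ≤ 1 / 2 + |t| := by positivity
    have h5 := mul_le_mul_of_nonneg_left h2 h4
    rw [h3]
    refine le_trans (le_of_eq (congrArg norm ?_)) ((norm_add_le _ _).trans
      ((add_le_add ih (h1.trans h5)).trans (le_of_eq ?_)))
    · ring
    · ring

lemma norm_natCast_cpow_div (n : ℕ) (hn : 0 < n) (t : ℝ) :
    ‖(n : ℂ) ^ (1 / 2 - Complex.I * t : ℂ) / (1 / 2 - Complex.I * t)‖ =
      √n / ‖(1 / 2 - Complex.I * t : ℂ)‖ := by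
  rw [norm_div, Complex.norm_natCast_cpow_of_pos hn]
  have : (1 / 2 - Complex.I * t : ℂ).re = 1 / 2 := by simp
  rw [this, ← Real.sqrt_eq_rpow]

lemma half_add_abs_div_two_le_norm (t : ℝ) : (1 + |t|) / 3 ≤ ‖(1 / 2 - Complex.I * t : ℂ)‖ := by
  have h1 := Complex.abs_re_le_norm (1 / 2 - Complex.I * t : ℂ)
  have h2 := Complex.abs_im_le_norm (1 / 2 - Complex.I * t : ℂ)
  have e1 : (1 / 2 - Complex.I * t : ℂ).re = 1 / 2 := by simp
  have e2 : (1 / 2 - Complex.I * t : ℂ).im = -t := by simp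
  rw [e1] at h1
  rw [e2, abs_neg] at h2
  rw [abs_of_pos (by norm_num)] at h1
  linarith

lemma norm_half_sub_le (t : ℝ) : ‖(1 / 2 - Complex.I * t : ℂ)‖ ≤ 1 + |t| := by
  refine (norm_sub_le _ _).trans ?_
  rw [norm_mul, Complex.norm_I, one_mul, Complex.norm_real, Real.norm_eq_abs]
  norm_num

/-- Comparison of the Dirichlet polynomial with its main term. -/
lemma norm_dirichletPartialSum_sub_main_le (t : ℝ) (N : ℕ) (hN : ⌊|t|⌋₊ + 1 ≤ N) :
    ‖(N : ℂ) ^ (1 / 2 - Complex.I * t : ℂ) / (1 / 2 - Complex.I * t) - dirichletPartialSum N t‖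
      ≤ 12 * √(1 + |t|) := by
  -- Cutting at $K\approx|t|$ balances the trivial bound $2\sqrt K$ for the head against the
  -- Euler–Maclaurin error $|t|/\sqrt K$ for the rest.
  set K := ⌊|t|⌋₊ + 1 with hK
  have hK1 : 1 ≤ K := by omega
  have hK1' : (1 : ℝ) ≤ K := by exact_mod_cast hK1
  have h := norm_dirichletPartialSum_sub_sub_le t K N hK1 hN
  have hKt : |t| ≤ K := by
    rw [hK]; push_cast; exact (Nat.lt_floor_add_one _).le
  have hKt' : (K : ℝ) ≤ 1 + |t| := by
    rw [hK]; push_cast; linarith [Nat.floor_le (abs_nonneg t)]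
  have hsK : 0 < √(K : ℝ) := Real.sqrt_pos.2 (by linarith)
  have h1 : √(K : ℝ) ≤ √(1 + |t|) := Real.sqrt_le_sqrt hKt'
  have h2 : ‖dirichletPartialSum K t‖ ≤ 2 * √(K : ℝ) := by
    have := norm_dirichletPartialSum_le K t
    rwa [Nat.floor_natCast] at this
  have h3 : ‖(K : ℂ) ^ (1 / 2 - Complex.I * t : ℂ) / (1 / 2 - Complex.I * t)‖ ≤ 3 * √(K : ℝ) := by
    rw [norm_natCast_cpow_div K hK1, div_le_iff₀]
    · have := half_add_abs_div_two_le_norm t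
      nlinarith [abs_nonneg t]
    · exact lt_of_lt_of_le (by positivity) (half_add_abs_div_two_le_norm t)
  have h4 : (1 / 2 + |t|) * (4 * (1 / √(K : ℝ) - 1 / √(N : ℝ))) ≤ 6 * √(K : ℝ) := by
    have a1 : 1 / √(K : ℝ) - 1 / √(N : ℝ) ≤ 1 / √(K : ℝ) := by
      have : 0 ≤ 1 / √(N : ℝ) := by positivity
      linarith
    calc (1 / 2 + |t|) * (4 * (1 / √(K : ℝ) - 1 / √(N : ℝ)))
        ≤ (3 / 2 * K) * (4 * (1 / √(K : ℝ))) := by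
          gcongr
          · have : 1 / √(N : ℝ) ≤ 1 / √(K : ℝ) := by gcongr
            linarith
          · linarith
      _ = 6 * (K / √(K : ℝ)) := by ring
      _ = 6 * √(K : ℝ) := by rw [Real.div_sqrt]
  have h5 : (N : ℂ) ^ (1 / 2 - Complex.I * t : ℂ) / (1 / 2 - Complex.I * t)
      - dirichletPartialSum N t =
      ((N : ℂ) ^ (1 / 2 - Complex.I * t : ℂ) / (1 / 2 - Complex.I * t)
      - (K : ℂ) ^ (1 / 2 - Complex.I * t : ℂ) / (1 / 2 - Complex.I * t)
      - (dirichletPartialSum N t - dirichletPartialSum K t)) +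
      (K : ℂ) ^ (1 / 2 - Complex.I * t : ℂ) / (1 / 2 - Complex.I * t)
      - dirichletPartialSum K t := by ring
  rw [h5]
  refine (norm_sub_le _ _).trans ?_
  have h6 := norm_add_le ((N : ℂ) ^ (1 / 2 - Complex.I * t : ℂ) / (1 / 2 - Complex.I * t)
      - (K : ℂ) ^ (1 / 2 - Complex.I * t : ℂ) / (1 / 2 - Complex.I * t)
      - (dirichletPartialSum N t - dirichletPartialSum K t))
      ((K : ℂ) ^ (1 / 2 - Complex.I * t : ℂ) / (1 / 2 - Complex.I * t))
  linarith

lemma dirichletPartialSum_natFloor (M t : ℝ) :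
    dirichletPartialSum (⌊M⌋₊ : ℕ) t = dirichletPartialSum M t := by
  rw [dirichletPartialSum, dirichletPartialSum, Nat.floor_natCast]

/-- Upper bound for the Dirichlet polynomial for all `t`. -/
lemma norm_dirichletPartialSum_le_add (M t : ℝ) :
    ‖dirichletPartialSum M t‖ ≤ 3 * √(⌊M⌋₊ : ℝ) / (1 + |t|) + 12 * √(1 + |t|) := by
  set N := ⌊M⌋₊ with hN
  have h0 : 0 < 1 + |t| := by positivity
  -- When the sum is no longer than about $|t|$, the trivial bound is already of size
  -- $\sqrt{1+|t|}$.
  rcases le_or_gt (⌊|t|⌋₊ + 1) N with h | h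
  · have h1 := norm_dirichletPartialSum_sub_main_le t N h
    rw [hN, dirichletPartialSum_natFloor, ← hN] at h1
    have h2 : ‖(N : ℂ) ^ (1 / 2 - Complex.I * t : ℂ) / (1 / 2 - Complex.I * t)‖ ≤
        3 * √(N : ℝ) / (1 + |t|) := by
      rw [norm_natCast_cpow_div N (by omega)]
      calc √(N : ℝ) / ‖(1 / 2 - Complex.I * t : ℂ)‖ ≤ √(N : ℝ) / ((1 + |t|) / 3) := by
            gcongr
            exact half_add_abs_div_two_le_norm t
        _ = _ := by field_simp
    have h3 := norm_sub_norm_le (dirichletPartialSum M t)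
      ((N : ℂ) ^ (1 / 2 - Complex.I * t : ℂ) / (1 / 2 - Complex.I * t))
    rw [norm_sub_rev] at h3
    linarith
  · have h1 := norm_dirichletPartialSum_le M t
    rw [← hN] at h1
    have h2 : (N : ℝ) ≤ 1 + |t| := by
      have h3 : (N : ℝ) < ⌊|t|⌋₊ + 1 := by exact_mod_cast h
      linarith [Nat.floor_le (abs_nonneg t)]
    have h3 : √(N : ℝ) ≤ √(1 + |t|) := Real.sqrt_le_sqrt h2
    have h4 : 0 ≤ 3 * √(N : ℝ) / (1 + |t|) := by positivity
    linarith [Real.sqrt_nonneg (1 + |t|)]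

/-- Lower bound for the Dirichlet polynomial when it is dominated by its main term. -/
lemma le_norm_dirichletPartialSum (M t : ℝ) (h : ⌊|t|⌋₊ + 1 ≤ ⌊M⌋₊) :
    √(⌊M⌋₊ : ℝ) / (1 + |t|) - 12 * √(1 + |t|) ≤ ‖dirichletPartialSum M t‖ := by
  set N := ⌊M⌋₊ with hN
  have h1 := norm_dirichletPartialSum_sub_main_le t N h
  rw [hN, dirichletPartialSum_natFloor, ← hN] at h1
  have h2 : √(N : ℝ) / (1 + |t|) ≤
      ‖(N : ℂ) ^ (1 / 2 - Complex.I * t : ℂ) / (1 / 2 - Complex.I * t)‖ := by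
    rw [norm_natCast_cpow_div N (by omega)]
    have : 0 < ‖(1 / 2 - Complex.I * t : ℂ)‖ :=
      lt_of_lt_of_le (by positivity) (half_add_abs_div_two_le_norm t)
    gcongr
    exact norm_half_sub_le t
  have h3 := norm_sub_norm_le ((N : ℂ) ^ (1 / 2 - Complex.I * t : ℂ) / (1 / 2 - Complex.I * t))
    (dirichletPartialSum M t)
  linarith

/-! ### The Gaussian weight and its kernel. -/

lemma integrable_gaussian_weight {δ : ℝ} (hδ : 0 < δ) :
    Integrable fun t : ℝ => Real.exp (-(δ ^ 2 / 2) * t ^ 2) :=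
  integrable_exp_neg_mul_sq (by positivity)

lemma integrable_cexp_mul_gaussian {δ : ℝ} (hδ : 0 < δ) (u : ℝ) :
    Integrable fun t : ℝ =>
      Complex.exp (-(Complex.I * u * t)) * (Real.exp (-(δ ^ 2 / 2) * t ^ 2) : ℂ) := by
  refine (integrable_gaussian_weight hδ).mono' (by fun_prop) (ae_of_all _ fun t => ?_)
  rw [norm_mul, Complex.norm_real, Real.norm_of_nonneg (Real.exp_pos _).le]
  have : ‖Complex.exp (-(Complex.I * u * t))‖ = 1 := by
    rw [Complex.norm_exp]
    simp
  rw [this, one_mul]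

/-- The transform is positive, which allows unwanted terms of the resonance sum to be kept or
dropped at will. -/
lemma integral_cexp_mul_gaussian {δ : ℝ} (hδ : 0 < δ) (u : ℝ) :
    ∫ t : ℝ, Complex.exp (-(Complex.I * u * t)) * (Real.exp (-(δ ^ 2 / 2) * t ^ 2) : ℂ) =
      ((√(2 * Real.pi) / δ * Real.exp (-(u / δ) ^ 2 / 2) : ℝ) : ℂ) := by
  have hb : 0 < ((δ ^ 2 / 2 : ℝ) : ℂ).re := by rw [Complex.ofReal_re]; positivity
  have h := fourierIntegral_gaussian hb (-(u : ℂ))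
  have e1 : ∀ t : ℝ, Complex.exp (-(Complex.I * u * t)) * (Real.exp (-(δ ^ 2 / 2) * t ^ 2) : ℂ) =
      Complex.exp (Complex.I * (-(u : ℂ)) * t) *
        Complex.exp (-((δ ^ 2 / 2 : ℝ) : ℂ) * (t : ℂ) ^ 2) := by
    intro t
    rw [Complex.ofReal_exp]
    congr 2
    · ring
    · push_cast; ring
  simp_rw [e1]
  rw [h]
  have e2 : (Real.pi : ℂ) / ((δ ^ 2 / 2 : ℝ) : ℂ) = ((2 * Real.pi / δ ^ 2 : ℝ) : ℂ) := by
    have : (δ : ℂ) ≠ 0 := by exact_mod_cast hδ.ne'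
    push_cast
    field_simp
  have e3 : ((2 * Real.pi / δ ^ 2 : ℝ) : ℂ) ^ (1 / 2 : ℂ) = ((√(2 * Real.pi) / δ : ℝ) : ℂ) := by
    have : (1 / 2 : ℂ) = ((1 / 2 : ℝ) : ℂ) := by push_cast; ring
    rw [this, ← Complex.ofReal_cpow (by positivity), ← Real.sqrt_eq_rpow,
      Real.sqrt_div (by positivity), Real.sqrt_sq hδ.le]
  rw [e2, e3]
  push_cast
  congr 2
  have : (δ : ℂ) ≠ 0 := by exact_mod_cast hδ.ne'
  field_simp
  ring

lemma exists_sum_exp_neg_sq_int_le :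
    ∃ C : ℝ, 0 < C ∧ ∀ (J : Finset ℤ) (j : ℤ),
      ∑ k ∈ J, Real.exp (-((j : ℝ) - k) ^ 2 / 2) ≤ C := by
  have hs : Summable fun k : ℤ => Real.exp (-(k : ℝ) ^ 2 / 2) := by
    have hnat : Summable fun k : ℕ => Real.exp (-(k : ℝ) ^ 2 / 2) := by
      refine Summable.of_nonneg_of_le (fun _ => (Real.exp_pos _).le) (fun k => ?_)
        (Real.summable_exp_nat_mul_iff.2 (show -(1 / 2 : ℝ) < 0 by norm_num))
      refine Real.exp_le_exp.2 ?_
      rcases Nat.eq_zero_or_pos k with rfl | hk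
      · simp
      · have : (1 : ℝ) ≤ k := by exact_mod_cast hk
        nlinarith
    refine Summable.of_nat_of_neg ?_ ?_
    · simpa using hnat
    · simpa using hnat
  refine ⟨∑' k : ℤ, Real.exp (-(k : ℝ) ^ 2 / 2),
    hs.tsum_pos (fun _ => (Real.exp_pos _).le) 0 (Real.exp_pos _), fun J j => ?_⟩
  have h1 : ∑ k ∈ J, Real.exp (-((j : ℝ) - k) ^ 2 / 2) =
      ∑ k ∈ J.image (fun k => j - k), Real.exp (-(k : ℝ) ^ 2 / 2) := by
    rw [Finset.sum_image (fun a _ b _ h => by simpa using h)]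
    push_cast
    rfl
  rw [h1]
  exact hs.sum_le_tsum _ fun _ _ => (Real.exp_pos _).le

/-- Schur's test for the Gaussian kernel on `ℤ`. -/
lemma sum_mul_mul_exp_le {C : ℝ} (hC : ∀ (J : Finset ℤ) (j : ℤ),
      ∑ k ∈ J, Real.exp (-((j : ℝ) - k) ^ 2 / 2) ≤ C) (J : Finset ℤ) (r : ℤ → ℝ) :
    ∑ j ∈ J, ∑ k ∈ J, r j * r k * Real.exp (-((j : ℝ) - k) ^ 2 / 2) ≤ C * ∑ j ∈ J, r j ^ 2 := by
  have h1 : ∑ j ∈ J, ∑ k ∈ J, r j ^ 2 * Real.exp (-((j : ℝ) - k) ^ 2 / 2) ≤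
      C * ∑ j ∈ J, r j ^ 2 := by
    rw [Finset.mul_sum]
    refine Finset.sum_le_sum fun j _ => ?_
    rw [← Finset.mul_sum, mul_comm C]
    exact mul_le_mul_of_nonneg_left (hC J j) (sq_nonneg _)
  have h2 : ∑ j ∈ J, ∑ k ∈ J, r k ^ 2 * Real.exp (-((j : ℝ) - k) ^ 2 / 2) =
      ∑ j ∈ J, ∑ k ∈ J, r j ^ 2 * Real.exp (-((j : ℝ) - k) ^ 2 / 2) := by
    rw [Finset.sum_comm]
    refine Finset.sum_congr rfl fun j _ => Finset.sum_congr rfl fun k _ => ?_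
    congr 2
    ring
  have h3 : ∑ j ∈ J, ∑ k ∈ J, r j * r k * Real.exp (-((j : ℝ) - k) ^ 2 / 2) ≤
      ∑ j ∈ J, ∑ k ∈ J, (1 / 2 * (r j ^ 2 * Real.exp (-((j : ℝ) - k) ^ 2 / 2)) +
        1 / 2 * (r k ^ 2 * Real.exp (-((j : ℝ) - k) ^ 2 / 2))) := by
    -- Termwise $2r_jr_k\le r_j^2+r_k^2$; the kernel is symmetric, so both halves have the same sum.
    refine Finset.sum_le_sum fun j _ => Finset.sum_le_sum fun k _ => ?_
    have := Real.exp_pos (-((j : ℝ) - k) ^ 2 / 2)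
    nlinarith [mul_nonneg (sq_nonneg (r j - r k)) this.le]
  simp_rw [Finset.sum_add_distrib, ← Finset.mul_sum] at h3
  simp_rw [← Finset.mul_sum] at h1 h2
  linarith

/-! ### The clustered resonator and the resonance inequality. -/

/-- The clustered coefficients: the `ℓ²` mass of `F` on the numbers `m` with
`⌊log m / δ⌋ = k`. -/
noncomputable def clusterCoeff (S : Finset ℕ) (F : ℕ → ℝ) (δ : ℝ) (k : ℤ) : ℝ :=
  √(∑ m ∈ S.filter (fun m : ℕ => ⌊Real.log m / δ⌋ = k), F m ^ 2)

/-- Cells of length $\delta$ on the logarithmic scale; a Gaussian of width $1/\delta$ in $t$ does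
not resolve frequencies inside one cell. -/
noncomputable def clusterSet (S : Finset ℕ) (δ : ℝ) : Finset ℤ :=
  S.image fun m : ℕ => ⌊Real.log m / δ⌋

lemma clusterCoeff_nonneg (S : Finset ℕ) (F : ℕ → ℝ) (δ : ℝ) (k : ℤ) :
    0 ≤ clusterCoeff S F δ k := Real.sqrt_nonneg _

lemma sum_clusterCoeff_sq (S : Finset ℕ) (F : ℕ → ℝ) (δ : ℝ) :
    ∑ k ∈ clusterSet S δ, clusterCoeff S F δ k ^ 2 = ∑ m ∈ S, F m ^ 2 := by
  rw [← Finset.sum_fiberwise_of_maps_to (t := clusterSet S δ)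
    (g := fun m : ℕ => ⌊Real.log m / δ⌋) (fun m hm => Finset.mem_image_of_mem _ hm)]
  refine Finset.sum_congr rfl fun k _ => ?_
  exact Real.sq_sqrt (Finset.sum_nonneg fun _ _ => sq_nonneg _)

/-- Cauchy–Schwarz. It yields the uniform bound for $|R(t)|^2$ used where $D_M$ is not controlled by
the maximum; this is why $|S|$ must be small. -/
lemma sq_sum_clusterCoeff_le (S : Finset ℕ) (F : ℕ → ℝ) (δ : ℝ) :
    (∑ k ∈ clusterSet S δ, clusterCoeff S F δ k) ^ 2 ≤ S.card * ∑ m ∈ S, F m ^ 2 := by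
  rw [← sum_clusterCoeff_sq S F δ]
  refine sq_sum_le_card_mul_sum_sq.trans ?_
  gcongr
  exact Finset.card_image_le

/-- If $m$ lies in cell $k$ and $mn$ in cell $k'$, then $|\log n+(k-k')\delta|\le\delta$, so the
Gaussian factor is at least $e^{-1/2}$. Cauchy–Schwarz bounds the sum over each pair of cells, and
pairs of cells that do not occur add nonnegative terms. -/
lemma sum_shift_le_clusterCoeff {S : Finset ℕ} {F : ℕ → ℝ} {δ : ℝ} (hδ : 0 < δ)
    (hS : ∀ m ∈ S, 0 < m) (n : ℕ) (hn : 0 < n) :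
    ∑ m ∈ S.filter (fun m => m * n ∈ S), F m * F (m * n) ≤
      Real.exp (1 / 2) * ∑ k ∈ clusterSet S δ, ∑ k' ∈ clusterSet S δ,
        clusterCoeff S F δ k * clusterCoeff S F δ k' *
          Real.exp (-((Real.log n + (k - k') * δ) / δ) ^ 2 / 2) := by
  set T := S.filter (fun m => m * n ∈ S) with hT
  have hTS : ∀ m ∈ T, m ∈ S ∧ m * n ∈ S := fun m hm => Finset.mem_filter.1 hm
  have key : ∀ k k' : ℤ, ∑ m ∈ T.filter (fun m : ℕ =>
      ((⌊Real.log m / δ⌋, ⌊Real.log ((m * n : ℕ) : ℝ) / δ⌋) : ℤ × ℤ) = (k, k')), F m * F (m * n) ≤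
      Real.exp (1 / 2) * (clusterCoeff S F δ k * clusterCoeff S F δ k' *
          Real.exp (-((Real.log n + (k - k') * δ) / δ) ^ 2 / 2)) := by
    intro k k'
    set U := T.filter (fun m : ℕ =>
      ((⌊Real.log m / δ⌋, ⌊Real.log ((m * n : ℕ) : ℝ) / δ⌋) : ℤ × ℤ) = (k, k')) with hU
    have hUm : ∀ m ∈ U, m ∈ T ∧ ⌊Real.log m / δ⌋ = k ∧ ⌊Real.log ((m * n : ℕ) : ℝ) / δ⌋ = k' := by
      intro m hm
      rw [hU, Finset.mem_filter, Prod.mk.injEq] at hm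
      exact hm
    have hr : 0 ≤ clusterCoeff S F δ k * clusterCoeff S F δ k' :=
      mul_nonneg (clusterCoeff_nonneg _ _ _ _) (clusterCoeff_nonneg _ _ _ _)
    rcases U.eq_empty_or_nonempty with h0 | ⟨m, hm⟩
    · rw [h0, Finset.sum_empty]
      positivity
    · have h1 : ∑ m ∈ U, F m * F (m * n) ≤ clusterCoeff S F δ k * clusterCoeff S F δ k' := by
        refine (Real.sum_mul_le_sqrt_mul_sqrt U F fun m => F (m * n)).trans ?_
        have a1 : √(∑ m ∈ U, F m ^ 2) ≤ clusterCoeff S F δ k := by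
          refine Real.sqrt_le_sqrt (Finset.sum_le_sum_of_subset_of_nonneg (fun m hm => ?_)
            fun _ _ _ => sq_nonneg _)
          obtain ⟨b1, b2, -⟩ := hUm m hm
          exact Finset.mem_filter.2 ⟨(hTS m b1).1, b2⟩
        have a2 : √(∑ m ∈ U, F (m * n) ^ 2) ≤ clusterCoeff S F δ k' := by
          have : ∑ m ∈ U, F (m * n) ^ 2 = ∑ m ∈ U.image (fun m => m * n), F m ^ 2 := by
            rw [Finset.sum_image fun a _ b _ h => Nat.eq_of_mul_eq_mul_right hn h]
          rw [this]
          refine Real.sqrt_le_sqrt (Finset.sum_le_sum_of_subset_of_nonneg (fun m hm => ?_)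
            fun _ _ _ => sq_nonneg _)
          obtain ⟨m', hm', rfl⟩ := Finset.mem_image.1 hm
          obtain ⟨b1, -, b2⟩ := hUm m' hm'
          exact Finset.mem_filter.2 ⟨(hTS m' b1).2, b2⟩
        exact mul_le_mul a1 a2 (Real.sqrt_nonneg _) (clusterCoeff_nonneg _ _ _ _)
      obtain ⟨b1, b2, b3⟩ := hUm m hm
      have hm0 : (0 : ℝ) < m := by exact_mod_cast hS m (hTS m b1).1
      have hn0 : (0 : ℝ) < n := by exact_mod_cast hn
      have hclose : ((Real.log n + (k - k') * δ) / δ) ^ 2 ≤ 1 := by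
        rw [Nat.cast_mul, Real.log_mul hm0.ne' hn0.ne', add_div] at b3
        have c1 := Int.floor_eq_iff.1 b2
        have c2 := Int.floor_eq_iff.1 b3
        have c3 : (Real.log n + (k - k') * δ) / δ = Real.log n / δ + (k - k') := by field_simp
        rw [c3, sq_le_one_iff_abs_le_one, abs_le]
        constructor <;> linarith [c1.1, c1.2, c2.1, c2.2]
      have h2 : 1 ≤ Real.exp (1 / 2) *
          Real.exp (-((Real.log n + (k - k') * δ) / δ) ^ 2 / 2) := by
        rw [← Real.exp_add]
        refine Real.one_le_exp ?_
        linarith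
      calc _ ≤ clusterCoeff S F δ k * clusterCoeff S F δ k' := h1
        _ ≤ clusterCoeff S F δ k * clusterCoeff S F δ k' * (Real.exp (1 / 2) *
          Real.exp (-((Real.log n + (k - k') * δ) / δ) ^ 2 / 2)) := le_mul_of_one_le_right hr h2
        _ = _ := by ring
  rw [← Finset.sum_fiberwise_of_maps_to (t := clusterSet S δ ×ˢ clusterSet S δ)
    (g := fun m : ℕ => (⌊Real.log m / δ⌋, ⌊Real.log ((m * n : ℕ) : ℝ) / δ⌋))
    (fun m hm => Finset.mem_product.2 ⟨Finset.mem_image_of_mem _ (hTS m hm).1,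
      Finset.mem_image.2 ⟨m * n, (hTS m hm).2, rfl⟩⟩), Finset.sum_product, Finset.mul_sum]
  refine Finset.sum_le_sum fun k _ => ?_
  rw [Finset.mul_sum]
  exact Finset.sum_le_sum fun k' _ => key k k'

/-- The resonator with clustered frequencies. -/
noncomputable def clusterResonator (S : Finset ℕ) (F : ℕ → ℝ) (δ t : ℝ) : ℂ :=
  ∑ k ∈ clusterSet S δ, (clusterCoeff S F δ k : ℂ) * Complex.exp (-(Complex.I * (k * δ) * t))

lemma norm_clusterResonator_sq_eq (S : Finset ℕ) (F : ℕ → ℝ) (δ t : ℝ) :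
    ((‖clusterResonator S F δ t‖ ^ 2 : ℝ) : ℂ) =
      ∑ k ∈ clusterSet S δ, ∑ k' ∈ clusterSet S δ,
        ((clusterCoeff S F δ k * clusterCoeff S F δ k' : ℝ) : ℂ) *
          Complex.exp (-(Complex.I * (((k - k') * δ : ℝ) : ℂ) * t)) := by
  rw [Complex.ofReal_pow, ← Complex.mul_conj', clusterResonator, map_sum, Finset.sum_mul_sum]
  refine Finset.sum_congr rfl fun k _ => Finset.sum_congr rfl fun k' _ => ?_
  rw [map_mul, Complex.conj_ofReal, ← Complex.exp_conj]
  have : (starRingEnd ℂ) (-(Complex.I * (k' * δ) * t)) = Complex.I * (k' * δ) * t := by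
    simp
  rw [this]
  rw [show (clusterCoeff S F δ k : ℂ) * Complex.exp (-(Complex.I * (k * δ) * t)) *
    ((clusterCoeff S F δ k' : ℂ) * Complex.exp (Complex.I * (k' * δ) * t)) =
    (clusterCoeff S F δ k * clusterCoeff S F δ k') * (Complex.exp (-(Complex.I * (k * δ) * t)) *
      Complex.exp (Complex.I * (k' * δ) * t)) by ring, ← Complex.exp_add]
  push_cast
  congr 2
  ring

lemma norm_clusterResonator_le (S : Finset ℕ) (F : ℕ → ℝ) (δ t : ℝ) :
    ‖clusterResonator S F δ t‖ ≤ ∑ k ∈ clusterSet S δ, clusterCoeff S F δ k := by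
  refine (norm_sum_le _ _).trans (Finset.sum_le_sum fun k _ => ?_)
  rw [norm_mul, Complex.norm_real, Real.norm_of_nonneg (clusterCoeff_nonneg _ _ _ _)]
  have : ‖Complex.exp (-(Complex.I * (k * δ) * t))‖ = 1 := by
    rw [Complex.norm_exp]
    simp
  rw [this, mul_one]

lemma natCast_cpow_eq_exp (n : ℕ) (hn : 0 < n) (t : ℝ) :
    (n : ℂ) ^ (-(1 / 2 : ℂ) - Complex.I * (t : ℂ)) =
      ((1 / √n : ℝ) : ℂ) * Complex.exp (-(Complex.I * (Real.log n : ℝ) * t)) := by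
  have hn0 : (n : ℂ) ≠ 0 := by exact_mod_cast hn.ne'
  have hn' : (0 : ℝ) < n := by exact_mod_cast hn
  rw [sub_eq_add_neg, Complex.cpow_add _ _ hn0, Complex.cpow_def_of_ne_zero hn0 (-(Complex.I * t)),
    ← Complex.natCast_log]
  congr 1
  · rw [one_div (√(n : ℝ)), Real.sqrt_eq_rpow, ← Real.rpow_neg hn'.le, Complex.ofReal_cpow hn'.le]
    push_cast
    rfl
  · congr 1
    ring

lemma dirichletPartialSum_mul_gaussian_eq (S : Finset ℕ) (F : ℕ → ℝ) (δ M t : ℝ) :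
    dirichletPartialSum M t * ((‖clusterResonator S F δ t‖ ^ 2 : ℝ) : ℂ) *
        (Real.exp (-(δ ^ 2 / 2) * t ^ 2) : ℂ) =
      ∑ n ∈ Finset.Icc 1 ⌊M⌋₊, ∑ k ∈ clusterSet S δ, ∑ k' ∈ clusterSet S δ,
        ((1 / √n * (clusterCoeff S F δ k * clusterCoeff S F δ k') : ℝ) : ℂ) *
          (Complex.exp (-(Complex.I * ((Real.log n + (k - k') * δ : ℝ) : ℂ) * t)) *
            (Real.exp (-(δ ^ 2 / 2) * t ^ 2) : ℂ)) := by
  rw [norm_clusterResonator_sq_eq, dirichletPartialSum, Finset.sum_mul, Finset.sum_mul]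
  refine Finset.sum_congr rfl fun n hn => ?_
  rw [natCast_cpow_eq_exp n (Finset.mem_Icc.1 hn).1, Finset.mul_sum, Finset.sum_mul]
  refine Finset.sum_congr rfl fun k _ => ?_
  rw [Finset.mul_sum, Finset.sum_mul]
  refine Finset.sum_congr rfl fun k' _ => ?_
  have : Complex.exp (-(Complex.I * ((Real.log n + (k - k') * δ : ℝ) : ℂ) * t)) =
      Complex.exp (-(Complex.I * (Real.log n : ℝ) * t)) *
        Complex.exp (-(Complex.I * (((k - k') * δ : ℝ) : ℂ) * t)) := by
    rw [← Complex.exp_add]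
    push_cast
    congr 1
    ring
  rw [this]
  push_cast
  ring

/-- The resonance inequality. -/
lemma exists_resonance_inequality :
    ∃ C : ℝ, 0 < C ∧ ∀ (S : Finset ℕ) (F : ℕ → ℝ) (δ M V : ℝ) (B : ℝ → ℝ),
      (∀ m ∈ S, 0 < m) → 0 < δ → 0 ≤ V → (∀ t, 0 ≤ B t) →
      (∀ t, ‖dirichletPartialSum M t‖ ≤ V + B t) →
      Integrable (fun t => B t * Real.exp (-(δ ^ 2 / 2) * t ^ 2)) →
      ∑ n ∈ Finset.Icc 1 ⌊M⌋₊, ∑ m ∈ S.filter (fun m => m * n ∈ S), F m * F (m * n) / √n ≤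
        (C * V + 2 * (S.card * (δ * ∫ t, B t * Real.exp (-(δ ^ 2 / 2) * t ^ 2)))) *
          ∑ m ∈ S, F m ^ 2 := by
  obtain ⟨C, hC0, hC⟩ := exists_sum_exp_neg_sq_int_le
  refine ⟨Real.exp (1 / 2) * C, by positivity, fun S F δ M V B hS hδ hV hB hD hint => ?_⟩
  set r := clusterCoeff S F δ with hr
  set J := clusterSet S δ with hJ
  set Q := √(2 * Real.pi) / δ with hQ
  have hQ0 : 0 < Q := by rw [hQ]; positivity
  set Num := ∑ n ∈ Finset.Icc 1 ⌊M⌋₊, ∑ k ∈ J, ∑ k' ∈ J, (1 / √n * (r k * r k')) *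
    Real.exp (-((Real.log n + (k - k') * δ) / δ) ^ 2 / 2) with hNum
  have hr0 : ∀ k, 0 ≤ r k := clusterCoeff_nonneg S F δ
  have hNum0 : 0 ≤ Num := Finset.sum_nonneg fun n _ => Finset.sum_nonneg fun k _ =>
    Finset.sum_nonneg fun k' _ => by
      have := hr0 k
      have := hr0 k'
      positivity
  have step1 : ∑ n ∈ Finset.Icc 1 ⌊M⌋₊, ∑ m ∈ S.filter (fun m => m * n ∈ S),
      F m * F (m * n) / √n ≤ Real.exp (1 / 2) * Num := by
    rw [hNum, Finset.mul_sum]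
    refine Finset.sum_le_sum fun n hn => ?_
    have h := sum_shift_le_clusterCoeff (F := F) hδ hS n (Finset.mem_Icc.1 hn).1
    rw [← Finset.sum_div]
    refine (div_le_div_of_nonneg_right h (Real.sqrt_nonneg _)).trans (le_of_eq ?_)
    rw [mul_div_assoc, Finset.sum_div]
    congr 1
    refine Finset.sum_congr rfl fun k _ => ?_
    rw [Finset.sum_div]
    refine Finset.sum_congr rfl fun k' _ => ?_
    ring
  have hInt1 : Integrable fun t : ℝ => dirichletPartialSum M t *
      ((‖clusterResonator S F δ t‖ ^ 2 : ℝ) : ℂ) * (Real.exp (-(δ ^ 2 / 2) * t ^ 2) : ℂ) := by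
    simp_rw [dirichletPartialSum_mul_gaussian_eq]
    refine integrable_finsetSum _ fun n _ => integrable_finsetSum _ fun k _ =>
      integrable_finsetSum _ fun k' _ => ?_
    exact (integrable_cexp_mul_gaussian hδ _).const_mul _
  have step2 : ∫ t : ℝ, dirichletPartialSum M t *
      ((‖clusterResonator S F δ t‖ ^ 2 : ℝ) : ℂ) * (Real.exp (-(δ ^ 2 / 2) * t ^ 2) : ℂ) =
      ((Q * Num : ℝ) : ℂ) := by
    simp_rw [dirichletPartialSum_mul_gaussian_eq]
    rw [integral_finsetSum _ fun n _ => integrable_finsetSum _ fun k _ =>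
      integrable_finsetSum _ fun k' _ => (integrable_cexp_mul_gaussian hδ _).const_mul _]
    rw [hNum, Finset.mul_sum, Complex.ofReal_sum]
    refine Finset.sum_congr rfl fun n _ => ?_
    rw [integral_finsetSum _ fun k _ =>
      integrable_finsetSum _ fun k' _ => (integrable_cexp_mul_gaussian hδ _).const_mul _,
      Finset.mul_sum, Complex.ofReal_sum]
    refine Finset.sum_congr rfl fun k _ => ?_
    rw [integral_finsetSum _ fun k' _ => (integrable_cexp_mul_gaussian hδ _).const_mul _,
      Finset.mul_sum, Complex.ofReal_sum]
    refine Finset.sum_congr rfl fun k' _ => ?_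
    rw [integral_const_mul, integral_cexp_mul_gaussian hδ]
    rw [← Complex.ofReal_mul]
    congr 1
    rw [hQ]
    ring
  have hInt2c : Integrable fun t : ℝ => ((‖clusterResonator S F δ t‖ ^ 2 : ℝ) : ℂ) *
      (Real.exp (-(δ ^ 2 / 2) * t ^ 2) : ℂ) := by
    simp_rw [norm_clusterResonator_sq_eq, Finset.sum_mul, mul_assoc]
    refine integrable_finsetSum _ fun k _ => integrable_finsetSum _ fun k' _ => ?_
    have := (integrable_cexp_mul_gaussian hδ ((k - k') * δ)).const_mul
      ((clusterCoeff S F δ k * clusterCoeff S F δ k' : ℝ) : ℂ)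
    simpa only [mul_assoc] using this
  have hInt2 : Integrable fun t : ℝ => ‖clusterResonator S F δ t‖ ^ 2 *
      Real.exp (-(δ ^ 2 / 2) * t ^ 2) := by
    have := hInt2c.re
    refine this.congr (ae_of_all _ fun t => ?_)
    simp only [← Complex.ofReal_mul]
    exact Complex.ofReal_re _
  have step3 : ∫ t : ℝ, ‖clusterResonator S F δ t‖ ^ 2 * Real.exp (-(δ ^ 2 / 2) * t ^ 2) =
      Q * ∑ k ∈ J, ∑ k' ∈ J, r k * r k' * Real.exp (-((k : ℝ) - k') ^ 2 / 2) := by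
    have h1 : ((∫ t : ℝ, ‖clusterResonator S F δ t‖ ^ 2 *
        Real.exp (-(δ ^ 2 / 2) * t ^ 2) : ℝ) : ℂ) =
        ∫ t : ℝ, ((‖clusterResonator S F δ t‖ ^ 2 : ℝ) : ℂ) *
          (Real.exp (-(δ ^ 2 / 2) * t ^ 2) : ℂ) := by
      rw [← integral_complex_ofReal]
      refine integral_congr_ae (ae_of_all _ fun t => ?_)
      simp only [Complex.ofReal_mul]
    have hI : ∀ k k' : ℤ, Integrable fun t : ℝ =>
        ((clusterCoeff S F δ k * clusterCoeff S F δ k' : ℝ) : ℂ) *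
          (Complex.exp (-(Complex.I * (((k - k') * δ : ℝ) : ℂ) * t)) *
            (Real.exp (-(δ ^ 2 / 2) * t ^ 2) : ℂ)) := fun k k' =>
      (integrable_cexp_mul_gaussian hδ ((k - k') * δ)).const_mul _
    have h2 : ∀ t : ℝ, ((‖clusterResonator S F δ t‖ ^ 2 : ℝ) : ℂ) *
          (Real.exp (-(δ ^ 2 / 2) * t ^ 2) : ℂ) = ∑ k ∈ J, ∑ k' ∈ J,
        ((clusterCoeff S F δ k * clusterCoeff S F δ k' : ℝ) : ℂ) *
          (Complex.exp (-(Complex.I * (((k - k') * δ : ℝ) : ℂ) * t)) *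
            (Real.exp (-(δ ^ 2 / 2) * t ^ 2) : ℂ)) := by
      intro t
      rw [norm_clusterResonator_sq_eq, Finset.sum_mul]
      refine Finset.sum_congr rfl fun k _ => ?_
      rw [Finset.sum_mul]
      exact Finset.sum_congr rfl fun k' _ => mul_assoc _ _ _
    apply Complex.ofReal_injective
    rw [h1]
    simp_rw [h2]
    rw [integral_finsetSum _ fun k _ => integrable_finsetSum _ fun k' _ => hI k k',
      Finset.mul_sum, Complex.ofReal_sum]
    refine Finset.sum_congr rfl fun k _ => ?_
    rw [integral_finsetSum _ fun k' _ => hI k k', Finset.mul_sum, Complex.ofReal_sum]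
    refine Finset.sum_congr rfl fun k' _ => ?_
    rw [integral_const_mul, integral_cexp_mul_gaussian hδ, ← Complex.ofReal_mul]
    congr 1
    have : ((k : ℝ) - k') * δ / δ = k - k' := by field_simp
    rw [this, hQ]
    ring
  have hR2 : ∀ t, ‖clusterResonator S F δ t‖ ^ 2 ≤ S.card * ∑ m ∈ S, F m ^ 2 := fun t =>
    (pow_le_pow_left₀ (norm_nonneg _) (norm_clusterResonator_le S F δ t) 2).trans
      (sq_sum_clusterCoeff_le S F δ)
  have hSF : 0 ≤ ∑ m ∈ S, F m ^ 2 := Finset.sum_nonneg fun _ _ => sq_nonneg _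
  -- The part $V$ of the bound for $|D_M|$ is integrated against $|R|^2$ and treated by Schur's
  -- test; the part $B$ is integrated after bounding $|R|^2$ by its supremum.
  have step4 : Q * Num ≤ V * (Q * (C * ∑ m ∈ S, F m ^ 2)) +
      S.card * (∑ m ∈ S, F m ^ 2) * ∫ t, B t * Real.exp (-(δ ^ 2 / 2) * t ^ 2) := by
    have h1 : Q * Num = ‖∫ t : ℝ, dirichletPartialSum M t *
      ((‖clusterResonator S F δ t‖ ^ 2 : ℝ) : ℂ) * (Real.exp (-(δ ^ 2 / 2) * t ^ 2) : ℂ)‖ := by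
      rw [step2, Complex.norm_real, Real.norm_of_nonneg (by positivity)]
    have h2 : ∑ k ∈ J, ∑ k' ∈ J, r k * r k' * Real.exp (-((k : ℝ) - k') ^ 2 / 2) ≤
        C * ∑ m ∈ S, F m ^ 2 := by
      rw [← sum_clusterCoeff_sq S F δ]
      exact sum_mul_mul_exp_le hC J r
    calc Q * Num ≤ ∫ t : ℝ, ‖dirichletPartialSum M t *
          ((‖clusterResonator S F δ t‖ ^ 2 : ℝ) : ℂ) *
            (Real.exp (-(δ ^ 2 / 2) * t ^ 2) : ℂ)‖ := by
          rw [h1]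
          exact norm_integral_le_integral_norm _
      _ ≤ ∫ t : ℝ, (V * (‖clusterResonator S F δ t‖ ^ 2 * Real.exp (-(δ ^ 2 / 2) * t ^ 2)) +
          S.card * (∑ m ∈ S, F m ^ 2) * (B t * Real.exp (-(δ ^ 2 / 2) * t ^ 2))) := by
          refine integral_mono hInt1.norm ((hInt2.const_mul _).add (hint.const_mul _)) fun t => ?_
          simp only [norm_mul, Complex.norm_real]
          rw [Real.norm_of_nonneg (Real.exp_pos _).le, Real.norm_of_nonneg (sq_nonneg _)]
          have hE := Real.exp_pos (-(δ ^ 2 / 2) * t ^ 2)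
          calc ‖dirichletPartialSum M t‖ * ‖clusterResonator S F δ t‖ ^ 2 *
                Real.exp (-(δ ^ 2 / 2) * t ^ 2)
              ≤ (V + B t) * ‖clusterResonator S F δ t‖ ^ 2 *
                Real.exp (-(δ ^ 2 / 2) * t ^ 2) := by
                gcongr
                exact hD t
            _ = V * (‖clusterResonator S F δ t‖ ^ 2 * Real.exp (-(δ ^ 2 / 2) * t ^ 2)) +
                ‖clusterResonator S F δ t‖ ^ 2 * (B t * Real.exp (-(δ ^ 2 / 2) * t ^ 2)) := by
                ring
            _ ≤ _ := by
                gcongr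
                · exact mul_nonneg (hB t) hE.le
                · exact hR2 t
      _ = V * (Q * ∑ k ∈ J, ∑ k' ∈ J, r k * r k' * Real.exp (-((k : ℝ) - k') ^ 2 / 2)) +
          S.card * (∑ m ∈ S, F m ^ 2) * ∫ t, B t * Real.exp (-(δ ^ 2 / 2) * t ^ 2) := by
          rw [integral_add (hInt2.const_mul _) (hint.const_mul _), integral_const_mul,
            integral_const_mul, step3]
      _ ≤ _ := by gcongr
  have hI0 : 0 ≤ ∫ t, B t * Real.exp (-(δ ^ 2 / 2) * t ^ 2) :=
    integral_nonneg fun t => mul_nonneg (hB t) (Real.exp_pos _).le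
  set I := ∫ t, B t * Real.exp (-(δ ^ 2 / 2) * t ^ 2) with hI
  set Z := ∑ m ∈ S, F m ^ 2 with hZ
  have hnum2 : Num ≤ V * (C * Z) + S.card * Z * (I / Q) := by
    have : Q * Num ≤ Q * (V * (C * Z) + S.card * Z * (I / Q)) := by
      refine step4.trans (le_of_eq ?_)
      field_simp
    exact le_of_mul_le_mul_left this hQ0
  have hexp : Real.exp (1 / 2) ≤ 2 := by
    have h1 : Real.exp (1 / 2) ^ 2 = Real.exp 1 := by rw [← Real.exp_nat_mul]; norm_num
    nlinarith [Real.exp_one_lt_d9, Real.exp_pos (1 / 2)]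
  have hIQ : I / Q ≤ δ * I := by
    rw [hQ, div_div_eq_mul_div, div_le_iff₀ (by positivity), mul_comm I δ]
    refine le_mul_of_one_le_right (by positivity) ?_
    rw [Real.one_le_sqrt]
    linarith [Real.pi_gt_three]
  calc _ ≤ Real.exp (1 / 2) * Num := step1
    _ ≤ Real.exp (1 / 2) * (V * (C * Z) + S.card * Z * (I / Q)) := by gcongr
    _ = Real.exp (1 / 2) * C * V * Z + Real.exp (1 / 2) * (S.card * Z * (I / Q)) := by ring
    _ ≤ Real.exp (1 / 2) * C * V * Z + 2 * (S.card * Z * (δ * I)) := by gcongr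
    _ = _ := by ring

/-! ### The contribution of $t$ outside $[\sqrt T,T]$. -/

lemma norm_dirichletPartialSum_neg (M t : ℝ) :
    ‖dirichletPartialSum M (-t)‖ = ‖dirichletPartialSum M t‖ := by
  have : dirichletPartialSum M (-t) = (starRingEnd ℂ) (dirichletPartialSum M t) := by
    rw [dirichletPartialSum, dirichletPartialSum, map_sum]
    refine Finset.sum_congr rfl fun n hn => ?_
    rw [natCast_cpow_eq_exp n (Finset.mem_Icc.1 hn).1, natCast_cpow_eq_exp n (Finset.mem_Icc.1 hn).1,
      map_mul, Complex.conj_ofReal, ← Complex.exp_conj]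
    congr 2
    rw [map_neg, map_mul, map_mul, Complex.conj_I, Complex.conj_ofReal, Complex.conj_ofReal,
      Complex.ofReal_neg]
    ring
  rw [this, Complex.norm_conj]

/-- The Gaussian integral runs over both signs of $t$, the maximum only over positive $t$. -/
lemma norm_dirichletPartialSum_abs (M t : ℝ) :
    ‖dirichletPartialSum M |t|‖ = ‖dirichletPartialSum M t‖ := by
  rcases abs_choice t with h | h
  · rw [h]
  · rw [h, norm_dirichletPartialSum_neg]

lemma integral_indicator_one_add_abs {X : ℝ} (hX : 0 ≤ X) (a b : ℝ) :
    Integrable (Set.indicator (Set.Icc (-X) X) fun t : ℝ => a / (1 + |t|) + b) ∧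
      ∫ t, Set.indicator (Set.Icc (-X) X) (fun t : ℝ => a / (1 + |t|) + b) t =
        2 * (a * Real.log (1 + X) + b * X) := by
  have hcont : ContinuousOn (fun t : ℝ => a / (1 + |t|) + b) Set.univ := by
    refine ContinuousOn.add (ContinuousOn.div continuousOn_const (by fun_prop) fun t _ => ?_)
      continuousOn_const
    positivity
  constructor
  · rw [integrable_indicator_iff measurableSet_Icc]
    exact (hcont.mono (Set.subset_univ _)).integrableOn_compact isCompact_Icc
  · have h1 : Set.indicator (Set.Icc (-X) X) (fun t : ℝ => a / (1 + |t|) + b) =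
        fun t => (Set.Iic X).indicator (fun s : ℝ => a / (1 + s) + b) |t| := by
      funext t
      by_cases ht : |t| ≤ X
      · rw [Set.indicator_of_mem (show t ∈ Set.Icc (-X) X from abs_le.1 ht),
          Set.indicator_of_mem (show |t| ∈ Set.Iic X from ht)]
      · rw [Set.indicator_of_notMem (show t ∉ Set.Icc (-X) X from fun h => ht (abs_le.2 h)),
          Set.indicator_of_notMem (show |t| ∉ Set.Iic X from ht)]
    have hlog : ∫ x in (0 : ℝ)..X, 1 / (1 + x) = Real.log (1 + X) := by
      have := intervalIntegral.integral_comp_add_left (a := 0) (b := X) (fun x : ℝ => 1 / x) 1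
      rw [this, integral_one_div_of_pos (by norm_num) (by linarith)]
      norm_num
    rw [h1, integral_comp_abs, setIntegral_indicator measurableSet_Iic, Set.Ioi_inter_Iic,
      ← intervalIntegral.integral_of_le hX]
    have hI : IntervalIntegrable (fun x : ℝ => a * (1 / (1 + x))) volume 0 X := by
      refine ContinuousOn.intervalIntegrable ?_
      refine continuousOn_const.mul (continuousOn_const.div (by fun_prop) fun x hx => ?_)
      rw [Set.uIcc_of_le hX] at hx
      linarith [hx.1]
    have h2 : ∫ x in (0 : ℝ)..X, (a / (1 + x) + b) = a * Real.log (1 + X) + b * X := by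
      have e : (fun x : ℝ => a / (1 + x) + b) = fun x => a * (1 / (1 + x)) + b := by
        funext x; ring
      rw [e, intervalIntegral.integral_add hI intervalIntegrable_const,
        intervalIntegral.integral_const_mul, hlog, intervalIntegral.integral_const]
      simp [mul_comm]
    rw [h2]

/-- A majorant of `|D_M(t)|` off the range `√T ≤ |t| ≤ T`. -/
noncomputable def tailMajorant (M X T t : ℝ) : ℝ :=
  Set.indicator (Set.Icc (-X) X)
    (fun t : ℝ => 3 * √(⌊M⌋₊ : ℝ) / (1 + |t|) + 12 * √(1 + X)) t +
  Set.indicator {t : ℝ | T < |t|} (fun _ => 2 * √(⌊M⌋₊ : ℝ)) t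

lemma tailMajorant_nonneg (M X T t : ℝ) : 0 ≤ tailMajorant M X T t :=
  add_nonneg (Set.indicator_nonneg (fun t _ => by positivity) _)
    (Set.indicator_nonneg (fun t _ => by positivity) _)

lemma norm_dirichletPartialSum_le_add_tailMajorant {M X T V : ℝ}
    (hV : ∀ t ∈ Set.Icc X T, ‖dirichletPartialSum M t‖ ≤ V) (hV0 : 0 ≤ V) (t : ℝ) :
    ‖dirichletPartialSum M t‖ ≤ V + tailMajorant M X T t := by
  have n1 : 0 ≤ Set.indicator (Set.Icc (-X) X)
      (fun t : ℝ => 3 * √(⌊M⌋₊ : ℝ) / (1 + |t|) + 12 * √(1 + X)) t :=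
    Set.indicator_nonneg (fun t _ => by positivity) _
  have n2 : 0 ≤ Set.indicator {t : ℝ | T < |t|} (fun _ => 2 * √(⌊M⌋₊ : ℝ)) t :=
    Set.indicator_nonneg (fun t _ => by positivity) _
  rw [tailMajorant]
  by_cases h1 : |t| ≤ X
  · have h2 := norm_dirichletPartialSum_le_add M t
    have h3 : √(1 + |t|) ≤ √(1 + X) := Real.sqrt_le_sqrt (by linarith)
    rw [Set.indicator_of_mem (show t ∈ Set.Icc (-X) X from abs_le.1 h1)]
    linarith
  · by_cases h2 : T < |t|
    · rw [Set.indicator_of_mem (show t ∈ {t : ℝ | T < |t|} from h2)]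
      linarith [norm_dirichletPartialSum_le M t]
    · have := hV |t| ⟨(not_le.1 h1).le, not_lt.1 h2⟩
      rw [norm_dirichletPartialSum_abs] at this
      linarith

/-- The weighted integral of the majorant. -/
lemma integral_tailMajorant_le {M X T δ : ℝ} (hX : 0 ≤ X) (hT : 0 ≤ T) (hδ : 0 < δ) :
    Integrable (fun t => tailMajorant M X T t * Real.exp (-(δ ^ 2 / 2) * t ^ 2)) ∧
    ∫ t, tailMajorant M X T t * Real.exp (-(δ ^ 2 / 2) * t ^ 2) ≤
      2 * (3 * √(⌊M⌋₊ : ℝ) * Real.log (1 + X) + 12 * √(1 + X) * X) +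
        2 * √(⌊M⌋₊ : ℝ) * Real.exp (-(δ * T) ^ 2 / 4) * (4 / δ) := by
  set q := √(⌊M⌋₊ : ℝ) with hq
  have hq0 : 0 ≤ q := Real.sqrt_nonneg _
  obtain ⟨i1, i2⟩ := integral_indicator_one_add_abs hX (3 * q) (12 * √(1 + X))
  have hmeas : MeasurableSet {t : ℝ | T < |t|} :=
    (isOpen_lt continuous_const continuous_abs).measurableSet
  have hg : Integrable fun t : ℝ => Real.exp (-(δ ^ 2 / 4) * t ^ 2) :=
    integrable_exp_neg_mul_sq (by positivity)
  have hmajor : Integrable fun t : ℝ =>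
      Set.indicator (Set.Icc (-X) X) (fun t : ℝ => 3 * q / (1 + |t|) + 12 * √(1 + X)) t +
        2 * q * Real.exp (-(δ * T) ^ 2 / 4) * Real.exp (-(δ ^ 2 / 4) * t ^ 2) :=
    i1.add (hg.const_mul _)
  -- For $|t|>T$ half of the Gaussian exponent is spent on the saving $e^{-(\delta T)^2/4}$ and the
  -- other half kept for integrability.
  have hle : ∀ t : ℝ, tailMajorant M X T t * Real.exp (-(δ ^ 2 / 2) * t ^ 2) ≤
      Set.indicator (Set.Icc (-X) X) (fun t : ℝ => 3 * q / (1 + |t|) + 12 * √(1 + X)) t +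
        2 * q * Real.exp (-(δ * T) ^ 2 / 4) * Real.exp (-(δ ^ 2 / 4) * t ^ 2) := by
    intro t
    rw [tailMajorant, add_mul]
    refine add_le_add ?_ ?_
    · refine mul_le_of_le_one_right (Set.indicator_nonneg (fun t _ => by positivity) _) ?_
      refine Real.exp_le_one_iff.2 ?_
      have : 0 ≤ δ ^ 2 / 2 * t ^ 2 := by positivity
      linarith
    · by_cases h : T < |t|
      · rw [Set.indicator_of_mem (show t ∈ {t : ℝ | T < |t|} from h), mul_assoc (2 * q),
          ← Real.exp_add]
        change 2 * q * _ ≤ _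
        gcongr
        have h1 : T ^ 2 ≤ t ^ 2 := by
          rw [← sq_abs t]
          gcongr
        have h2 : δ ^ 2 * T ^ 2 ≤ δ ^ 2 * t ^ 2 := by gcongr
        nlinarith
      · rw [Set.indicator_of_notMem (show t ∉ {t : ℝ | T < |t|} from h), zero_mul]
        positivity
  have hmeasB : AEStronglyMeasurable
      (fun t => tailMajorant M X T t * Real.exp (-(δ ^ 2 / 2) * t ^ 2)) volume := by
    refine AEStronglyMeasurable.mul ?_ (by fun_prop)
    exact i1.aestronglyMeasurable.add
      (aestronglyMeasurable_const.indicator hmeas)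
  have hint : Integrable (fun t => tailMajorant M X T t * Real.exp (-(δ ^ 2 / 2) * t ^ 2)) := by
    refine hmajor.mono' hmeasB (ae_of_all _ fun t => ?_)
    rw [Real.norm_of_nonneg (mul_nonneg (tailMajorant_nonneg _ _ _ _) (Real.exp_pos _).le)]
    exact hle t
  refine ⟨hint, (integral_mono hint hmajor hle).trans ?_⟩
  rw [integral_add i1 (hg.const_mul _), i2, integral_const_mul, integral_gaussian]
  have h4 : √(Real.pi / (δ ^ 2 / 4)) ≤ 4 / δ := by
    rw [Real.sqrt_le_left (by positivity), div_pow]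
    rw [div_div_eq_mul_div, div_le_div_iff_of_pos_right (by positivity)]
    linarith [Real.pi_le_four]
  gcongr

/-! ### The two ranges of $M$ and the conclusion. -/

/-- The range where `M` is so large that the main term `M^{1/2-it}/(1/2-it)` dominates. -/
lemma exp_sqrt_log_le_norm_of_large {ε l M : ℝ} (hε0 : 0 < ε) (hl : 16 ≤ l)
    (hbig : 60 ≤ Real.exp (ε / 2 * l)) (hM : Real.exp ((3 / 2 + ε) * l) ≤ M) :
    Real.exp (√l) ≤ ‖dirichletPartialSum M (√(Real.exp l))‖ := by
  have hX : √(Real.exp l) = Real.exp (l / 2) := by rw [← Real.exp_half]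
  set X := √(Real.exp l) with hXdef
  have hX1 : 2 ≤ X := by
    rw [hX]
    linarith [Real.add_one_le_exp (l / 2)]
  have hX0 : 0 ≤ X := by linarith
  have hq : Real.exp (l / 4) ^ 2 = X := by
    rw [hX, ← Real.exp_nat_mul]; congr 1; push_cast; ring
  set q := Real.exp (l / 4) with hqdef
  have hq0 : 0 < q := Real.exp_pos _
  have hMX : X + 1 ≤ M := by
    refine le_trans ?_ hM
    have h1 : X * X ≤ Real.exp ((3 / 2 + ε) * l) := by
      rw [hX, ← Real.exp_add]
      refine Real.exp_le_exp.2 ?_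
      nlinarith
    nlinarith
  have hM0 : 0 < M := by linarith
  have hfl : M / 2 ≤ (⌊M⌋₊ : ℝ) := by
    have := Nat.lt_floor_add_one M
    linarith
  have hfloor : ⌊|X|⌋₊ + 1 ≤ ⌊M⌋₊ := by
    rw [abs_of_nonneg hX0]
    refine Nat.le_floor ?_
    push_cast
    linarith [Nat.floor_le hX0]
  have h := le_norm_dirichletPartialSum M X hfloor
  rw [abs_of_nonneg hX0] at h
  refine le_trans ?_ h
  have h1 : √(1 + X) ≤ 3 / 2 * q := by
    rw [Real.sqrt_le_left (by positivity), mul_pow, hq]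
    linarith
  -- With $q=T^{1/4}$ and $1+\sqrt T\le\frac32q^2$, the main term is at least $\frac{80}3q$, the
  -- error at most $12\cdot\frac32q=18q$, and $q\ge e^{\sqrt l}$ since $l\ge 16$.
  have h2 : 40 * q ^ 3 ≤ √(⌊M⌋₊ : ℝ) := by
    refine Real.le_sqrt_of_sq_le ?_
    have e1 : Real.exp ((3 / 2 + ε) * l) = q ^ 6 * Real.exp (ε / 2 * l) ^ 2 := by
      rw [hqdef, ← Real.exp_nat_mul, ← Real.exp_nat_mul, ← Real.exp_add]
      congr 1
      push_cast
      ring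
    have e2 : q ^ 6 * 60 ^ 2 ≤ M := by
      refine le_trans ?_ hM
      rw [e1]
      gcongr
    have e3 : (40 * q ^ 3) ^ 2 = 1600 * q ^ 6 := by ring
    rw [e3]
    linarith
  have h3 : 80 / 3 * q ≤ √(⌊M⌋₊ : ℝ) / (1 + X) := by
    rw [le_div_iff₀ (by linarith)]
    refine le_trans ?_ h2
    have : 1 + X ≤ 3 / 2 * q ^ 2 := by rw [hq]; linarith
    calc 80 / 3 * q * (1 + X) ≤ 80 / 3 * q * (3 / 2 * q ^ 2) := by gcongr
      _ = _ := by ring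
  have h4 : Real.exp (√l) ≤ q := by
    refine Real.exp_le_exp.2 ?_
    rw [Real.sqrt_le_left (by positivity)]
    nlinarith
  linarith

/-- The error term of the resonance inequality is negligible for `M < T^{3/2+ε}`. -/
lemma resonance_error_le_one {ε l M : ℝ} (hε0 : 0 < ε) (hε1 : ε ≤ 1 / 10) (hl : 4 ≤ l)
    (hM0 : 0 ≤ M) (hM : M ≤ Real.exp ((3 / 2 + ε) * l))
    (hbig : 136 * l ^ 2 ≤ Real.exp (ε / 4 * l)) {K : ℝ}
    (hK : K ≤ Real.exp ((1 / 2 - ε) ^ 2 * l)) :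
    2 * (K * (l / Real.exp l *
      ∫ t, tailMajorant M (√(Real.exp l)) (Real.exp l) t *
        Real.exp (-((l / Real.exp l) ^ 2 / 2) * t ^ 2))) ≤ 1 := by
  have hl0 : 0 < l := by linarith
  have hδ : 0 < l / Real.exp l := by positivity
  have h := (integral_tailMajorant_le (M := M) (Real.sqrt_nonneg (Real.exp l))
    (Real.exp_pos l).le hδ).2
  set I := ∫ t, tailMajorant M (√(Real.exp l)) (Real.exp l) t *
        Real.exp (-((l / Real.exp l) ^ 2 / 2) * t ^ 2) with hI
  have hI0 : 0 ≤ I := integral_nonneg fun t =>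
    mul_nonneg (tailMajorant_nonneg _ _ _ _) (Real.exp_pos _).le
  have hX : √(Real.exp l) = Real.exp (l / 2) := by rw [← Real.exp_half]
  have hq : √(⌊M⌋₊ : ℝ) ≤ Real.exp ((3 / 4 + ε / 2) * l) := by
    rw [Real.sqrt_le_left (by positivity), ← Real.exp_nat_mul]
    refine (Nat.floor_le hM0).trans (hM.trans (le_of_eq ?_))
    congr 1
    push_cast
    ring
  have hX3 : 1 + Real.exp (l / 2) ≤ 4 * Real.exp (l / 2) := by
    have : 1 ≤ Real.exp (l / 2) := Real.one_le_exp (by linarith)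
    linarith
  have hXl : 1 + Real.exp (l / 2) ≤ Real.exp l := by
    have e1 : Real.exp (l / 2) * Real.exp (l / 2) = Real.exp l := by
      rw [← Real.exp_add]; congr 1; ring
    have : 2 ≤ Real.exp (l / 2) := by linarith [Real.add_one_le_exp (l / 2)]
    nlinarith
  have hlogX : Real.log (1 + √(Real.exp l)) ≤ l := by
    rw [hX, Real.log_le_iff_le_exp (by positivity)]
    exact hXl
  have hsq : √(1 + √(Real.exp l)) ≤ 2 * Real.exp (l / 4) := by
    rw [hX, Real.sqrt_le_left (by positivity), mul_pow, ← Real.exp_nat_mul]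
    refine hX3.trans (le_of_eq ?_)
    norm_num
    ring
  have hsqX : √(1 + √(Real.exp l)) * √(Real.exp l) ≤ 2 * Real.exp ((3 / 4 + ε / 2) * l) := by
    calc √(1 + √(Real.exp l)) * √(Real.exp l) ≤ 2 * Real.exp (l / 4) * Real.exp (l / 2) := by
          rw [hX] at hsq ⊢
          gcongr
      _ = 2 * Real.exp (l / 4 + l / 2) := by rw [mul_assoc, ← Real.exp_add]
      _ ≤ _ := by
          gcongr
          nlinarith
  -- Here $\delta T=l$, so the Gaussian tail $e^{-l^2/4}$ outweighs the factor $4/\delta\le T$.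
  have htail : Real.exp (-(l / Real.exp l * Real.exp l) ^ 2 / 4) * (4 / (l / Real.exp l)) ≤ 1 := by
    have e1 : l / Real.exp l * Real.exp l = l := by field_simp
    have e2 : 4 / (l / Real.exp l) ≤ Real.exp l := by
      rw [div_div_eq_mul_div, div_le_iff₀ hl0]
      nlinarith [Real.exp_pos l]
    rw [e1]
    calc _ ≤ Real.exp (-l ^ 2 / 4) * Real.exp l := by gcongr
      _ = Real.exp (-l ^ 2 / 4 + l) := by rw [← Real.exp_add]
      _ ≤ 1 := Real.exp_le_one_iff.2 (by nlinarith)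
  set E := Real.exp ((3 / 4 + ε / 2) * l) with hE
  have hE0 : 0 < E := Real.exp_pos _
  have hIle : I ≤ 68 * l * E := by
    refine h.trans ?_
    have t1 : √(⌊M⌋₊ : ℝ) * Real.log (1 + √(Real.exp l)) ≤ E * l := by
      gcongr
      exact Real.log_nonneg (by linarith [Real.sqrt_nonneg (Real.exp l)])
    have t2 : √(⌊M⌋₊ : ℝ) * (Real.exp (-(l / Real.exp l * Real.exp l) ^ 2 / 4) *
        (4 / (l / Real.exp l))) ≤ E * 1 := by gcongr
    have t3 : E ≤ E * l := le_mul_of_one_le_right hE0.le (by linarith)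
    nlinarith
  -- The total exponent of $T$ is
  -- $(1/2-\varepsilon)^2+3/4+\varepsilon/2-1=-\varepsilon/2+\varepsilon^2\le-\varepsilon/4$.
  have hfin : Real.exp ((1 / 2 - ε) ^ 2 * l) * (E / Real.exp l) ≤ Real.exp (-(ε / 4 * l)) := by
    rw [hE, ← Real.exp_sub, ← Real.exp_add]
    refine Real.exp_le_exp.2 ?_
    have : (1 / 2 - ε) ^ 2 + (3 / 4 + ε / 2) - 1 ≤ -(ε / 4) := by nlinarith
    nlinarith
  calc 2 * (K * (l / Real.exp l * I))
      ≤ 2 * (Real.exp ((1 / 2 - ε) ^ 2 * l) * (l / Real.exp l * (68 * l * E))) := by gcongr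
    _ = 136 * l ^ 2 * (Real.exp ((1 / 2 - ε) ^ 2 * l) * (E / Real.exp l)) := by ring
    _ ≤ Real.exp (ε / 4 * l) * Real.exp (-(ε / 4 * l)) := by gcongr
    _ = 1 := by rw [← Real.exp_add, add_neg_cancel, Real.exp_zero]

/-- The expression is continuous with value $1/2$ at $\varepsilon=0$. -/
lemma exists_small_parameter {c : ℝ} (hc1 : c < 1 / 2) :
    ∃ ε : ℝ, 0 < ε ∧ ε ≤ 1 / 10 ∧ c < (1 / 2 - ε) / (1 + ε) ^ 3 * (1 - ε) ^ 3 := by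
  have hcont : ContinuousAt (fun ε : ℝ => (1 / 2 - ε) / (1 + ε) ^ 3 * (1 - ε) ^ 3) 0 := by
    refine ContinuousAt.mul (ContinuousAt.div (by fun_prop) (by fun_prop) (by norm_num))
      (by fun_prop)
  have h0 : c < (fun ε : ℝ => (1 / 2 - ε) / (1 + ε) ^ 3 * (1 - ε) ^ 3) 0 := by
    norm_num
    linarith
  have h1 := (hcont.eventually_const_lt h0).filter_mono (nhdsWithin_le_nhds (s := Set.Ioi 0))
  have h2 : ∀ᶠ ε : ℝ in 𝓝[>] 0, ε ∈ Set.Ioc (0 : ℝ) (1 / 10) :=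
    Ioc_mem_nhdsGT (by norm_num)
  obtain ⟨ε, hε, hε'⟩ := (h1.and h2).exists
  exact ⟨ε, hε'.1, hε'.2, hε⟩

theorem theorem2 (c : ℝ) (hc0 : 0 < c) (hc1 : c < 1 / 2) :
    ∃ T₀ : ℝ, ∀ T : ℝ, T₀ ≤ T → ∀ M : ℝ,
      Real.exp (Real.exp 1 *
        Real.sqrt (Real.log T * Real.log (Real.log T) * Real.log (Real.log (Real.log T)) / 2))
          ≤ M →
      ∃ t₀ ∈ Set.Icc (Real.sqrt T) T,
        IsMaxOn (fun t : ℝ => ‖dirichletPartialSum M t‖) (Set.Icc (Real.sqrt T) T) t₀ ∧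
        Real.exp (c *
          Real.sqrt (Real.log T * Real.log (Real.log (Real.log T)) / Real.log (Real.log T)))
            ≤ ‖dirichletPartialSum M t₀‖ := by
  obtain ⟨ε, hε0, hε1, hcε⟩ := exists_small_parameter hc1
  obtain ⟨s, hs⟩ : ∃ s, s = (1 / 2 - ε) / (1 + ε) ^ 3 := ⟨_, rfl⟩
  rw [← hs] at hcε
  obtain ⟨C, hC0, hres⟩ := exists_resonance_inequality
  -- The spare exponent $d$ serves to absorb the absolute constant of the resonance inequality.
  set d := s * (1 - ε) ^ 3 - c with hd
  have hd0 : 0 < d := by linarith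
  have hlog := Real.tendsto_log_atTop
  have e1 : ∀ᶠ l : ℝ in atTop, 60 ≤ Real.exp (ε / 2 * l) :=
    (Real.tendsto_exp_atTop.comp (tendsto_id.const_mul_atTop (half_pos hε0))).eventually_ge_atTop _
  have e2 : ∀ᶠ l : ℝ in atTop, 136 * l ^ 2 ≤ Real.exp (ε / 4 * l) := by
    have h1 := (isLittleO_pow_exp_pos_mul_atTop 2 (show 0 < ε / 4 by positivity)).bound
      (show (0 : ℝ) < 1 / 136 by norm_num)
    filter_upwards [h1] with l hl
    rw [Real.norm_of_nonneg (sq_nonneg l), Real.norm_of_nonneg (Real.exp_pos _).le] at hl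
    linarith
  have e3 : ∀ᶠ l : ℝ in atTop, Real.log l ≤ √l := by
    have h2 := (isLittleO_log_rpow_atTop (show (0 : ℝ) < 1 / 2 by norm_num)).bound one_pos
    filter_upwards [h2, eventually_gt_atTop 1] with x hx hx0
    rw [Real.norm_of_nonneg (Real.log_nonneg hx0.le), Real.norm_of_nonneg (by positivity),
      ← Real.sqrt_eq_rpow, one_mul] at hx
    exact hx
  have e4 : ∀ᶠ l : ℝ in atTop, (Real.log (C + 1) / d) ^ 2 ≤ √l :=
    Real.tendsto_sqrt_atTop.eventually_ge_atTop _
  have e5 : ∀ᶠ l : ℝ in atTop, 1 ≤ Real.log (Real.log l) :=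
    (hlog.comp hlog).eventually_ge_atTop _
  have e6 : ∀ᶠ x : ℝ in atTop, Real.log x ≤ x := by
    filter_upwards [eventually_gt_atTop 0] with x hx
    linarith [Real.log_le_sub_one_of_pos hx]
  have hev := hlog.eventually ((eventually_exists_resonator hε0 hε1 hs).and (e1.and (e2.and
    (e3.and (e4.and (e5.and ((hlog.eventually (e6.and (eventually_gt_atTop 0))).and
      (eventually_ge_atTop 16))))))))
  obtain ⟨T₀, hT₀⟩ := eventually_atTop.1 (hev.and (eventually_gt_atTop 1))
  refine ⟨T₀, fun T hT M hM => ?_⟩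
  obtain ⟨⟨hreson, h1, h2, h3, h4, h5, ⟨h6, h7⟩, h8⟩, hT1⟩ := hT₀ T hT
  have hTpos : 0 < T := by linarith
  obtain ⟨l, hl⟩ : ∃ l, l = Real.log T := ⟨_, rfl⟩
  have hTl : T = Real.exp l := by rw [hl, Real.exp_log hTpos]
  rw [← hl] at hreson h1 h2 h3 h4 h5 h6 h7 h8 hM ⊢
  have hl0 : 0 < l := by linarith
  have hsq : √T ≤ T := by
    rw [Real.sqrt_le_left hTpos.le]
    nlinarith
  obtain ⟨t₀, ht₀, hmax⟩ := isCompact_Icc.exists_isMaxOn (Set.nonempty_Icc.2 hsq)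
    (continuous_dirichletPartialSum M).norm.continuousOn
  refine ⟨t₀, ht₀, hmax, ?_⟩
  set R := √(l * Real.log (Real.log l) / Real.log l) with hR
  rcases le_or_gt (Real.exp ((3 / 2 + ε) * l)) M with hbig | hsmall
  · have hle := exp_sqrt_log_le_norm_of_large hε0 h8 h1 hbig
    rw [← hTl] at hle
    refine le_trans ?_ (hle.trans (hmax (Set.left_mem_Icc.2 hsq)))
    refine Real.exp_le_exp.2 ?_
    have hRl : R ≤ √l := by
      refine Real.sqrt_le_sqrt ?_
      rw [div_le_iff₀ h7]
      gcongr
    have hR0 : 0 ≤ R := Real.sqrt_nonneg _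
    nlinarith
  · have hM0 : 0 < M := (Real.exp_pos _).trans_le hM
    -- The polynomial has length $\lfloor M\rfloor$, which may fall below the threshold; only
    -- $M<\lfloor M\rfloor+1$ is available, whence the $N+1$ in the resonator's hypothesis.
    obtain ⟨S, F, hS, -, hSF, hcard, hlow⟩ := hreson ⌊M⌋₊ (hM.trans (Nat.lt_floor_add_one M).le)
    have hδ : 0 < l / Real.exp l := by positivity
    have hV0 : 0 ≤ ‖dirichletPartialSum M t₀‖ := norm_nonneg _
    have hres' := hres S F (l / Real.exp l) M ‖dirichletPartialSum M t₀‖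
      (tailMajorant M (√(Real.exp l)) (Real.exp l)) hS hδ hV0
      (tailMajorant_nonneg _ _ _)
      (norm_dirichletPartialSum_le_add_tailMajorant
        (fun t ht => by rw [← hTl] at ht; exact hmax ht) hV0)
      (integral_tailMajorant_le (Real.sqrt_nonneg _) (Real.exp_pos _).le hδ).1
    have herr := resonance_error_le_one hε0 hε1 (by linarith) hM0.le hsmall.le h2 hcard
    have hmain : Real.exp (s * (1 - ε) ^ 3 * R) ≤ C * ‖dirichletPartialSum M t₀‖ + 1 := by
      refine le_of_mul_le_mul_right (hlow.trans (hres'.trans ?_)) hSF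
      gcongr
    have hRbig : Real.log (C + 1) / d ≤ R := by
      refine Real.le_sqrt_of_sq_le (h4.trans ?_)
      rw [le_div_iff₀ h7]
      calc √l * Real.log l ≤ √l * √l := by gcongr
        _ = l := Real.mul_self_sqrt hl0.le
        _ ≤ l * Real.log (Real.log l) := le_mul_of_one_le_right hl0.le h5
    have hexp : C + 1 ≤ Real.exp (d * R) := by
      rw [div_le_iff₀ hd0] at hRbig
      rw [← Real.log_le_iff_le_exp (by linarith)]
      linarith
    have hsplit : Real.exp (s * (1 - ε) ^ 3 * R) = Real.exp (d * R) * Real.exp (c * R) := by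
      rw [← Real.exp_add, hd]
      congr 1
      ring
    have hc1' : 1 ≤ Real.exp (c * R) := Real.one_le_exp (by positivity)
    -- Since $e^{cR}\ge 1$, the error $1$ is absorbed by the extra copy of $e^{cR}$ in
    -- $(C+1)e^{cR}$.
    have hfin : (C + 1) * Real.exp (c * R) ≤ C * ‖dirichletPartialSum M t₀‖ + 1 := by
      refine le_trans ?_ hmain
      rw [hsplit]
      gcongr
    have : C * Real.exp (c * R) ≤ C * ‖dirichletPartialSum M t₀‖ := by linarith
    exact le_of_mul_le_mul_left this hC0
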